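/- Let $\mathcal B$ be a Boolean algebra with least element $0$. A submeasure on $\mathcal B$ is a map $\nu:\mathcal B\to[0,\infty)$ with $\nu(0)=0$, $\nu(A)\le\nu(B)$ whenever $A\subset B$, and $\nu(A\cup B)\le\nu(A)+\nu(B)$ for all $A,B\in\mathcal B$. A measure is a finitely additive one, i.e. a submeasure with $\nu(A\cup B)=\nu(A)+\nu(B)$ whenever $A\cap B=0$. A submeasure $\nu$ is positive if $\nu(A)=0$ implies $A=0$, and continuous if $\nu(A_n)\to0$ for every decreasing sequence $(A_n)$ in $\mathcal B$ with $\bigcap_nA_n=0$. $\mathcal B$ is $\sigma$-complete if each of its countable subsets has a least upper bound. A submeasure algebra (respectively, a measure algebra) is a $\sigma$-complete Boolean algebra on which there is a positive continuous submeasure (respectively, a positive continuous measure). Theorem 1.2. There exists a submeasure algebra $\mathcal B$ that is not a measure algebra. In fact, there does not exist a positive (finitely additive) measure on $\mathcal B$, and there does not exist a non-zero continuous measure on $\mathcal B$ either. -/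

import Mathlib

open scoped NNReal

namespace Maharam

/-- Every countable subset has a least upper bound. -/
def IsSigmaComplete (B : Type*) [BooleanAlgebra B] : Prop :=
  ∀ s : Set B, s.Countable → ∃ a : B, IsLUB s a

/-- A (finite, nonnegative real valued) submeasure on a Boolean algebra. -/
structure IsSubmeasure {B : Type*} [BooleanAlgebra B] (ν : B → ℝ≥0) : Prop where
  map_bot : ν ⊥ = 0
  mono : ∀ a b : B, a ≤ b → ν a ≤ ν b
  map_sup_le : ∀ a b : B, ν (a ⊔ b) ≤ ν a + ν b

/-- A finitely additive measure: a submeasure that is additive on disjoint pairs.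
No countable additivity is required. -/
structure IsMeasure {B : Type*} [BooleanAlgebra B] (μ : B → ℝ≥0) : Prop
    extends IsSubmeasure μ where
  map_sup_of_disjoint : ∀ a b : B, Disjoint a b → μ (a ⊔ b) = μ a + μ b

/-- Continuity: `ν (A n)` tends to `0` along every decreasing sequence with infimum `⊥`. -/
def IsContinuous {B : Type*} [BooleanAlgebra B] (ν : B → ℝ≥0) : Prop :=
  ∀ A : ℕ → B, Antitone A → IsGLB (Set.range A) ⊥ →
    Filter.Tendsto (fun n => ν (A n)) Filter.atTop (nhds 0)

/-- Positivity: only the zero element has value `0`. -/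
def IsPositive {B : Type*} [BooleanAlgebra B] (ν : B → ℝ≥0) : Prop :=
  ∀ a : B, ν a = 0 → a = ⊥

/-- A σ-complete Boolean algebra carrying a positive continuous submeasure. -/
def IsSubmeasureAlgebra (B : Type*) [BooleanAlgebra B] : Prop :=
  IsSigmaComplete B ∧ ∃ ν : B → ℝ≥0, IsSubmeasure ν ∧ IsPositive ν ∧ IsContinuous ν

/-- A σ-complete Boolean algebra carrying a positive continuous measure. -/
def IsMeasureAlgebra (B : Type*) [BooleanAlgebra B] : Prop :=
  IsSigmaComplete B ∧ ∃ μ : B → ℝ≥0, IsMeasure μ ∧ IsPositive μ ∧ IsContinuous μ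

end Maharam

namespace Maharam

/-! The algebra is the completion of the cylinder sets of `Pt` for `coverWeight`, the infimum of the
weights of finite covers by marks of `limCls 0`. Three facts carry the proof: this submeasure is at
least 16 on the whole space, it tends to zero along disjoint sequences, and every finitely additive
measure is concentrated on sets where it is small.

A mark of rank `r` is cheap when it has many indices, and its set must be thin: for indices `m < n`,
the continuations of any prefix of length `m` that avoid the `n`-hull of the set cannot be covered
with weight below 1 by marks of higher rank. Hence `cls` is built from a top rank down, and `limCls`
removes the top rank by an ultrafilter limit.

Lower bound (`heavy_univ_cls`, through `exists_avoiding`): a cover that is too light has few marks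
of lowest rank, each with many indices, so each can be given its own gap `[m, n)`. Rewriting the
coordinates in the gap leaves the thin set together with the few higher marks concentrated there;
pulling the other marks back along the rewriting costs a factor near 1, and induction on the number
of ranks applies.

Exhaustivity (`eventually_light`): above an atom, either a finite union of terms is heavy, and the
hulls of later terms miss it, or all finite unions are light, and the compactness in
`exists_limit_marks` gives nested covers with light tails. Either way late terms are thin up to a
light part; iterating makes them marks of weight `2^(-k)` up to a small error.

Pathology (`exists_coverWeight_le`): avoiding one value at each of `maxCard k` coordinates is a
light condition, yet for far coordinates with well chosen values its complement has small measure.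
In the completion, `exists_submeasureAlgebra`, countable suprema of such sets have small submeasure
and complements of measure zero, which excludes positive measures and nonzero continuous ones. -/

/-- The product space on which the submeasure lives; its coordinates range over
finite sets of increasing size. -/
abbrev Pt := ∀ i : ℕ, Fin (i + 1)

/-! ### Prefixes, hulls and causal maps -/

/-- Two points have the same first `n` coordinates. -/
def AgreeBelow (n : ℕ) (x y : Pt) : Prop := ∀ i < n, x i = y i

theorem AgreeBelow.refl (n : ℕ) (x : Pt) : AgreeBelow n x x := fun _ _ => rfl

theorem AgreeBelow.symm {n : ℕ} {x y : Pt} (h : AgreeBelow n x y) : AgreeBelow n y x :=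
  fun i hi => (h i hi).symm

theorem AgreeBelow.trans {n : ℕ} {x y z : Pt} (h : AgreeBelow n x y) (h' : AgreeBelow n y z) :
    AgreeBelow n x z :=
  fun i hi => (h i hi).trans (h' i hi)

theorem AgreeBelow.mono {m n : ℕ} {x y : Pt} (h : AgreeBelow n x y) (hmn : m ≤ n) :
    AgreeBelow m x y :=
  fun i hi => h i (hi.trans_le hmn)

/-- The point with the first `m` coordinates of `a` and the remaining ones of `z`. -/
def splice (m : ℕ) (a z : Pt) : Pt := fun i => if i < m then a i else z i

theorem splice_of_lt {m i : ℕ} (h : i < m) (a z : Pt) : splice m a z i = a i := if_pos h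

theorem splice_of_le {m i : ℕ} (h : m ≤ i) (a z : Pt) : splice m a z i = z i :=
  if_neg (not_lt.mpr h)

theorem agreeBelow_splice (m : ℕ) (a z : Pt) : AgreeBelow m (splice m a z) a :=
  fun _ hi => splice_of_lt hi a z

theorem splice_eq_self {m : ℕ} {a z : Pt} (h : AgreeBelow m z a) : splice m a z = z := by
  funext i
  rcases lt_or_ge i m with hi | hi
  · rw [splice_of_lt hi, h i hi]
  · rw [splice_of_le hi]

theorem splice_splice (m : ℕ) (a b z : Pt) : splice m a (splice m b z) = splice m a z := by
  funext i
  rcases lt_or_ge i m with hi | hi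
  · rw [splice_of_lt hi, splice_of_lt hi]
  · rw [splice_of_le hi, splice_of_le hi, splice_of_le hi]

/-- Membership in `S` depends only on the first `n` coordinates. -/
def DependsBelow (n : ℕ) (S : Set Pt) : Prop := ∀ x y, AgreeBelow n x y → x ∈ S → y ∈ S

theorem DependsBelow.mono {m n : ℕ} {S : Set Pt} (h : DependsBelow m S) (hmn : m ≤ n) :
    DependsBelow n S :=
  fun x y hxy => h x y (hxy.mono hmn)

/-- Membership in `S` does not depend on the first `m` coordinates. -/
def FreeBelow (m : ℕ) (S : Set Pt) : Prop := ∀ x z, z ∈ S → splice m x z ∈ S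

/-- The smallest set depending on the first `n` coordinates and containing `S`. -/
def hull (n : ℕ) (S : Set Pt) : Set Pt := {z | ∃ y ∈ S, AgreeBelow n y z}

theorem dependsBelow_hull (n : ℕ) (S : Set Pt) : DependsBelow n (hull n S) :=
  fun _ _ hxy ⟨u, hu, hux⟩ => ⟨u, hu, hux.trans hxy⟩

theorem hull_subset_hull {m n : ℕ} {S S' : Set Pt} (hmn : m ≤ n) (h : S ⊆ S') :
    hull n S ⊆ hull m S' :=
  fun _ ⟨u, hu, huz⟩ => ⟨u, h hu, huz.mono hmn⟩

theorem hull_hull {m n : ℕ} (hmn : m ≤ n) (S : Set Pt) : hull m (hull n S) ⊆ hull m S :=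
  fun _ ⟨_, ⟨v, hv, hvu⟩, huz⟩ => ⟨v, hv, (hvu.mono hmn).trans huz⟩

theorem FreeBelow.hull {m : ℕ} {S : Set Pt} (h : FreeBelow m S) (n : ℕ) :
    FreeBelow m (hull n S) := by
  rintro x z ⟨u, hu, huz⟩
  refine ⟨splice m x u, h x u hu, fun i hi => ?_⟩
  rcases lt_or_ge i m with him | him
  · rw [splice_of_lt him, splice_of_lt him]
  · rw [splice_of_le him, splice_of_le him, huz i hi]

/-- The first `n` coordinates of `Φ z` are determined by those of `z`. -/
def Causal (Φ : Pt → Pt) : Prop := ∀ n x y, AgreeBelow n x y → AgreeBelow n (Φ x) (Φ y)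

/-- `Φ` leaves the coordinates in `[m, n)` unchanged. -/
def FixesBetween (m n : ℕ) (Φ : Pt → Pt) : Prop := ∀ z i, m ≤ i → i < n → Φ z i = z i

theorem causal_splice (m : ℕ) (a : Pt) : Causal (splice m a) := by
  intro n x y h i hi
  rcases lt_or_ge i m with him | him
  · rw [splice_of_lt him, splice_of_lt him]
  · rw [splice_of_le him, splice_of_le him, h i hi]

/-! ### Marks, weights and thinness -/

/-- A set of points together with a set of indices along which it is thin and a rank. -/
structure Mark where
  set : Set Pt
  idx : Finset ℕ
  rank : ℕ

/-- The exponent in the weight of marks of rank `r`. -/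
noncomputable def expo (r : ℕ) : ℝ := ((2 : ℝ) ^ (r + 3))⁻¹

/-- The largest number of indices of a mark of rank `r`. -/
def maxCard (r : ℕ) : ℕ := 2 ^ (2 * r + 20) * 2 ^ ((r + 5) * 2 ^ (r + 3))

/-- The weight of a mark of rank `r` with `c` indices. -/
noncomputable def weight (r c : ℕ) : ℝ := ((2 : ℝ) ^ r)⁻¹ * ((maxCard r : ℝ) / c) ^ expo r

/-- The weight of a mark. -/
noncomputable def Mark.wt (e : Mark) : ℝ := weight e.rank e.idx.card

/-- Every finite cover of `S` by marks from `C` has weight at least `c`. -/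
def Heavy (C : Set Mark) (c : ℝ) (S : Set Pt) : Prop :=
  ∀ F : Finset Mark, (∀ e ∈ F, e ∈ C) → (∀ z ∈ S, ∃ e ∈ F, z ∈ e.set) → c ≤ ∑ e ∈ F, e.wt

/-- Above every atom of level `m` the complement of the level `n` hull of `X` is heavy. -/
def Thin (C : Set Mark) (m n : ℕ) (X : Set Pt) : Prop :=
  ∀ a, Heavy C 1 {z | splice m a z ∉ hull n X}

/-- `X` is thin between any two indices from `I`. -/
def ThinOn (C : Set Mark) (I : Finset ℕ) (X : Set Pt) : Prop :=
  ∀ m ∈ I, ∀ n ∈ I, m < n → Thin C m n X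

/-- The marks of rank `k` whose set is thin with respect to `C`. -/
def layer (C : Set Mark) (k : ℕ) : Set Mark :=
  {e | e.rank = k ∧ e.idx.Nonempty ∧ e.idx.card ≤ maxCard k ∧ ThinOn C e.idx e.set}

/-- The class of marks of rank from `k` up to `k + d - 1`, built from the highest rank down. -/
def cls : ℕ → ℕ → Set Mark
  | 0, _ => ∅
  | d + 1, k => cls d (k + 1) ∪ layer (cls d (k + 1)) k

theorem weight_nonneg (r c : ℕ) : 0 ≤ weight r c := by unfold weight; positivity

theorem Mark.wt_nonneg (e : Mark) : 0 ≤ e.wt := weight_nonneg _ _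

theorem Heavy.mono_set {C : Set Mark} {c : ℝ} {S S' : Set Pt} (h : Heavy C c S) (hS : S ⊆ S') :
    Heavy C c S' :=
  fun F hF hc => h F hF fun z hz => hc z (hS hz)

theorem Heavy.le_sum {C : Set Mark} {c : ℝ} {S : Set Pt} (h : Heavy C c S) {ι : Type*}
    (F : Finset ι) (g : ι → Mark) (hF : ∀ f ∈ F, g f ∈ C)
    (hc : ∀ z ∈ S, ∃ f ∈ F, z ∈ (g f).set) : c ≤ ∑ f ∈ F, (g f).wt := by
  classical
  refine (h (F.image g) ?_ ?_).trans ?_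
  · intro e he
    obtain ⟨f, hf, rfl⟩ := Finset.mem_image.mp he
    exact hF f hf
  · intro z hz
    obtain ⟨f, hf, hzf⟩ := hc z hz
    exact ⟨g f, Finset.mem_image_of_mem g hf, hzf⟩
  · exact Finset.sum_image_le_of_nonneg fun e _ => e.wt_nonneg

theorem Heavy.exists_notMem {C : Set Mark} {c : ℝ} {S : Set Pt} (h : Heavy C c S) {ι : Type*}
    (F : Finset ι) (g : ι → Mark) (hF : ∀ f ∈ F, g f ∈ C) (hw : ∑ f ∈ F, (g f).wt < c) :
    ∃ z ∈ S, ∀ f ∈ F, z ∉ (g f).set := by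
  by_contra! hcon
  exact absurd (h.le_sum F g hF hcon) (not_le.mpr hw)

theorem Thin.mono {C : Set Mark} {m n n' : ℕ} {X Y : Set Pt} (h : Thin C m n X) (hn : n ≤ n')
    (hY : Y ⊆ X) : Thin C m n' Y :=
  fun a => (h a).mono_set fun _ hz hz' => hz (hull_subset_hull hn hY hz')

theorem Thin.hull_set {C : Set Mark} {m n l : ℕ} {X : Set Pt} (h : Thin C m n X) (hn : n ≤ l) :
    Thin C m n (hull l X) :=
  fun a => (h a).mono_set fun _ hz hz' => hz (hull_hull hn X hz')

/-- Causality maps the `n`-hull of the preimage into the `n`-hull of `X`. The prefix `a` becomes `Φ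
a`, which is harmless because thinness concerns all prefixes, and on `[m, n)` nothing changes. -/
theorem Thin.preimage {C : Set Mark} {m n : ℕ} {X : Set Pt} (h : Thin C m n X) {Φ : Pt → Pt}
    (hΦ : Causal Φ) (hfix : FixesBetween m n Φ) : Thin C m n (Φ ⁻¹' X) := by
  refine fun a => (h (Φ a)).mono_set ?_
  rintro z hz ⟨y, hy, hyz⟩
  refine hz ⟨Φ y, hy, (hΦ n _ _ hyz).trans fun i hi => ?_⟩
  rcases lt_or_ge i m with him | him
  · rw [splice_of_lt him, hΦ m _ _ (agreeBelow_splice m a z) i him]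
  · rw [splice_of_le him, hfix _ i him hi, splice_of_le him]

/-- The closure properties of the classes `cls d k`. -/
structure Stable (C : Set Mark) : Prop where
  idx_nonempty : ∀ e ∈ C, e.idx.Nonempty
  preimage : ∀ e ∈ C, ∀ Φ : Pt → Pt, Causal Φ → ∀ I ⊆ e.idx, I.Nonempty →
    (∀ m ∈ I, ∀ n ∈ I, m < n → ∃ n' ∈ e.idx, m < n' ∧ n' ≤ n ∧ FixesBetween m n' Φ) →
    (⟨Φ ⁻¹' e.set, I, e.rank⟩ : Mark) ∈ C
  hull : ∀ e ∈ C, ∀ l, (e.idx.filter (· < l)).Nonempty →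
    (⟨hull l e.set, e.idx.filter (· < l), e.rank⟩ : Mark) ∈ C

theorem stable_layer (C : Set Mark) (k : ℕ) : Stable (layer C k) where
  idx_nonempty e he := he.2.1
  preimage := by
    rintro e ⟨hr, -, hc, ht⟩ Φ hΦ I hI hne hfix
    refine ⟨hr, hne, (Finset.card_le_card hI).trans hc, fun m hm n hn hmn => ?_⟩
    obtain ⟨n', hn', hmn', hle, hf⟩ := hfix m hm n hn hmn
    exact ((ht m (hI hm) n' hn' hmn').preimage hΦ hf).mono hle subset_rfl
  hull := by
    rintro e ⟨hr, -, hc, ht⟩ l hne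
    refine ⟨hr, hne, (Finset.card_le_card (Finset.filter_subset _ _)).trans hc,
      fun m hm n hn hmn => ?_⟩
    obtain ⟨hm, -⟩ := Finset.mem_filter.mp hm
    obtain ⟨hn, hnl⟩ := Finset.mem_filter.mp hn
    exact (ht m hm n hn hmn).hull_set hnl.le

theorem Stable.union {C C' : Set Mark} (h : Stable C) (h' : Stable C') : Stable (C ∪ C') where
  idx_nonempty e he := he.elim (h.idx_nonempty e) (h'.idx_nonempty e)
  preimage e he Φ hΦ I hI hne hf :=
    he.imp (fun he => h.preimage e he Φ hΦ I hI hne hf) fun he => h'.preimage e he Φ hΦ I hI hne hf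
  hull e he l hl := he.imp (fun he => h.hull e he l hl) fun he => h'.hull e he l hl

theorem stable_cls (d k : ℕ) : Stable (cls d k) := by
  induction d generalizing k with
  | zero => exact ⟨by simp [cls], by simp [cls], by simp [cls]⟩
  | succ d ih => exact (ih (k + 1)).union (stable_layer _ k)

theorem le_rank_of_mem_cls {d k : ℕ} {e : Mark} (he : e ∈ cls d k) : k ≤ e.rank := by
  induction d generalizing k with
  | zero => exact absurd he (by simp [cls])
  | succ d ih =>
    rcases he with he | he
    · exact (Nat.le_succ k).trans (ih he)
    · exact he.1.ge

/-! ### Weight estimates -/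

theorem maxCard_pos (r : ℕ) : 0 < maxCard r := by unfold maxCard; positivity

theorem expo_pos (r : ℕ) : 0 < expo r := by unfold expo; positivity

theorem expo_anti {r k : ℕ} (h : k ≤ r) : expo r ≤ expo k := by
  unfold expo
  gcongr
  norm_num

theorem weight_le_of_le_mul {r c c' : ℕ} {x : ℝ} (hc : 0 < c) (hc' : 0 < c') (hx : 0 ≤ x)
    (h : (c : ℝ) ≤ x * c') : weight r c' ≤ x ^ expo r * weight r c := by
  have hcR : (0 : ℝ) < c := by exact_mod_cast hc
  have hcR' : (0 : ℝ) < c' := by exact_mod_cast hc'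
  unfold weight
  rw [mul_left_comm, ← Real.mul_rpow hx (by positivity)]
  refine mul_le_mul_of_nonneg_left ?_ (by positivity)
  refine Real.rpow_le_rpow (by positivity) ?_ (expo_pos r).le
  rw [mul_div_assoc', div_le_div_iff₀ hcR' hcR]
  nlinarith [(Nat.cast_nonneg (maxCard r) : (0 : ℝ) ≤ maxCard r)]

/-- The exponent `expo r` is so small that keeping only a `2^(-(k+7))` share of the indices at most
doubles the weight. -/
theorem weight_le_two_mul_of_pow {r k c c' : ℕ} (hk : k + 7 ≤ 2 ^ (r + 3)) (hc : 0 < c)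
    (h : (c : ℝ) ≤ 2 ^ (k + 7) * c') : weight r c' ≤ 2 * weight r c := by
  have hc' : 0 < c' := by
    rcases Nat.eq_zero_or_pos c' with rfl | h'
    · simp only [Nat.cast_zero, mul_zero] at h
      have : c ≤ 0 := by exact_mod_cast h
      omega
    · exact h'
  refine (weight_le_of_le_mul hc hc' (by positivity) h).trans ?_
  refine mul_le_mul_of_nonneg_right ?_ (weight_nonneg _ _)
  rw [← Real.rpow_natCast, ← Real.rpow_mul (by norm_num)]
  calc (2 : ℝ) ^ (((k + 7 : ℕ) : ℝ) * expo r) ≤ 2 ^ (1 : ℝ) := by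
        refine Real.rpow_le_rpow_of_exponent_le (by norm_num) ?_
        unfold expo
        rw [← div_eq_mul_inv, div_le_one (by positivity)]
        exact_mod_cast hk
    _ = 2 := Real.rpow_one 2

theorem weight_le_two_mul {r c c' : ℕ} (hc : 0 < c) (h : c ≤ 2 * c') :
    weight r c' ≤ 2 * weight r c := by
  have hc' : 0 < c' := by omega
  refine (weight_le_of_le_mul hc hc' zero_le_two (by exact_mod_cast h)).trans ?_
  refine mul_le_mul_of_nonneg_right ?_ (weight_nonneg _ _)
  calc (2 : ℝ) ^ expo r ≤ 2 ^ (1 : ℝ) := by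
        refine Real.rpow_le_rpow_of_exponent_le (by norm_num) ?_
        unfold expo
        exact inv_le_one_of_one_le₀ (one_le_pow₀ (by norm_num))
    _ = 2 := Real.rpow_one 2

theorem weight_maxCard (r : ℕ) : weight r (maxCard r) = ((2 : ℝ) ^ r)⁻¹ := by
  have : ((maxCard r : ℕ) : ℝ) ≠ 0 := by exact_mod_cast (maxCard_pos r).ne'
  rw [weight, div_self this, Real.one_rpow, mul_one]

theorem le_weight {r c : ℕ} (hc : 0 < c) (h : c ≤ maxCard r) : ((2 : ℝ) ^ r)⁻¹ ≤ weight r c := by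
  have hcR : (0 : ℝ) < c := by exact_mod_cast hc
  refine le_mul_of_one_le_right (by positivity) (Real.one_le_rpow ?_ (expo_pos r).le)
  rw [one_le_div hcR]
  exact_mod_cast h

/-- The second factor of `maxCard r`, raised to the power `expo r`, is `2^(r+5)`; against the
prefactor `2^(-r)` this leaves 32. -/
theorem le_card_of_weight_lt {r c : ℕ} (hc : 0 < c) (h : weight r c < 32) :
    2 ^ (2 * r + 20) ≤ c := by
  by_contra! hlt
  have hcR : (0 : ℝ) < c := by exact_mod_cast hc
  refine absurd h (not_lt.mpr ?_)
  have hE : (0 : ℝ) < 2 ^ (r + 3) := by positivity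
  have h1 : (2 : ℝ) ^ ((r + 5) * 2 ^ (r + 3)) ≤ (maxCard r : ℝ) / c := by
    rw [le_div_iff₀ hcR, maxCard, mul_comm]
    push_cast
    gcongr
    exact_mod_cast hlt.le
  have h2 : ((2 : ℝ) ^ ((r + 5) * 2 ^ (r + 3))) ^ expo r = 2 ^ (r + 5) := by
    rw [← Real.rpow_natCast, ← Real.rpow_mul (by norm_num), expo]
    push_cast
    rw [mul_assoc, mul_inv_cancel₀ hE.ne', mul_one]
    exact_mod_cast Real.rpow_natCast 2 (r + 5)
  calc (32 : ℝ) = ((2 : ℝ) ^ r)⁻¹ * 2 ^ (r + 5) := by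
        rw [pow_add, inv_mul_cancel_left₀ (by positivity)]; norm_num
    _ ≤ weight r c := by
        refine mul_le_mul_of_nonneg_left ?_ (by positivity)
        rw [← h2]
        exact Real.rpow_le_rpow (by positivity) h1 (expo_pos r).le

/-- The lower bound for the weight of the covers of the whole space by marks of rank at least
`k`. -/
noncomputable def bound (k : ℕ) : ℝ := (2 : ℝ) ^ (5 - ((2 : ℝ) ^ k)⁻¹)

theorem bound_lt (k : ℕ) : bound k < 32 := by
  have h : bound k < (2 : ℝ) ^ (5 : ℝ) :=
    Real.rpow_lt_rpow_of_exponent_lt (by norm_num) (by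
      have : (0 : ℝ) < ((2 : ℝ) ^ k)⁻¹ := by positivity
      linarith)
  refine h.trans_le (le_of_eq ?_)
  norm_num [show (5 : ℝ) = ((5 : ℕ) : ℝ) by norm_num]

theorem le_bound (k : ℕ) : 16 ≤ bound k := by
  have h : (2 : ℝ) ^ (4 : ℝ) ≤ bound k :=
    Real.rpow_le_rpow_of_exponent_le (by norm_num) (by
      have : ((2 : ℝ) ^ k)⁻¹ ≤ 1 := inv_le_one_of_one_le₀ (one_le_pow₀ (by norm_num))
      linarith)
  refine le_trans (le_of_eq ?_) h
  norm_num [show (4 : ℝ) = ((4 : ℕ) : ℝ) by norm_num]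

/-- The factor by which weights grow when one gap is removed from the index sets. -/
noncomputable def growth (k : ℕ) : ℝ := (1 - 2 / 2 ^ (k + 7))⁻¹ ^ expo (k + 1)

theorem two_div_pow_le (k : ℕ) : (2 : ℝ) / 2 ^ (k + 7) ≤ 1 / 2 := by
  rw [div_le_div_iff₀ (by positivity) (by norm_num)]
  have : (1 : ℝ) ≤ 2 ^ k := one_le_pow₀ (by norm_num)
  rw [pow_add]; nlinarith

theorem growth_nonneg (k : ℕ) : 0 ≤ growth k := by
  have := two_div_pow_le k
  exact Real.rpow_nonneg (inv_nonneg.mpr (by linarith)) _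

theorem weight_le_growth_mul {r k c c' : ℕ} (hk : k + 1 ≤ r) (hc : 0 < c)
    (h : (1 - 2 / 2 ^ (k + 7)) * (c : ℝ) ≤ c') : weight r c' ≤ growth k * weight r c := by
  have h2 := two_div_pow_le k
  have hp : (0 : ℝ) < 1 - 2 / 2 ^ (k + 7) := by linarith
  have hcR : (0 : ℝ) < c := by exact_mod_cast hc
  have hc' : 0 < c' := by
    have : (0 : ℝ) < c' := (mul_pos hp hcR).trans_le h
    exact_mod_cast this
  refine (weight_le_of_le_mul hc hc' (inv_nonneg.mpr hp.le) ?_).trans ?_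
  · rwa [← div_eq_inv_mul, le_div_iff₀' hp]
  · refine mul_le_mul_of_nonneg_right ?_ (weight_nonneg _ _)
    refine Real.rpow_le_rpow_of_exponent_le ?_ (expo_anti hk)
    rw [one_le_inv₀ hp]
    have : (0 : ℝ) ≤ 2 / 2 ^ (k + 7) := by positivity
    linarith

/-- By Bernoulli, `2^(k+5)` losses of a share `2/2^(k+7)` still leave one half. The total growth is
thus at most `2 ^ expo (k+1)`, and the exponents in `bound k` and `bound (k+1)` differ by more than
that. -/
theorem growth_pow_mul_bound_le {k s : ℕ} (hs : s ≤ 2 ^ (k + 5)) :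
    growth k ^ s * bound k ≤ bound (k + 1) := by
  have h2 := two_div_pow_le k
  have hp : (0 : ℝ) < 1 - 2 / 2 ^ (k + 7) := by linarith
  have hb : (1 : ℝ) / 2 ≤ (1 - 2 / 2 ^ (k + 7)) ^ s := by
    have hB := one_add_mul_le_pow (a := -((2 : ℝ) / 2 ^ (k + 7))) (by linarith) s
    rw [← sub_eq_add_neg] at hB
    refine le_trans ?_ hB
    have hs' : (s : ℝ) ≤ 2 ^ (k + 5) := by exact_mod_cast hs
    have : (s : ℝ) * (2 / 2 ^ (k + 7)) ≤ 2 ^ (k + 5) * (2 / 2 ^ (k + 7)) := by gcongr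
    have h3 : (2 : ℝ) ^ (k + 5) * (2 / 2 ^ (k + 7)) = 1 / 2 := by
      rw [pow_add, pow_add]; field_simp
    linarith
  have hg : growth k ^ s ≤ (2 : ℝ) ^ expo (k + 1) := by
    unfold growth
    rw [← Real.rpow_natCast, ← Real.rpow_mul (inv_nonneg.mpr hp.le), mul_comm,
      Real.rpow_mul (inv_nonneg.mpr hp.le), Real.rpow_natCast, inv_pow]
    refine Real.rpow_le_rpow (by positivity) ?_ (expo_pos _).le
    rw [inv_le_comm₀ (by positivity) (by norm_num)]
    linarith
  refine (mul_le_mul_of_nonneg_right hg (Real.rpow_nonneg (by norm_num) _)).trans ?_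
  unfold bound
  rw [← Real.rpow_add (by norm_num)]
  refine Real.rpow_le_rpow_of_exponent_le (by norm_num) ?_
  unfold expo
  have h4 : ((2 : ℝ) ^ (k + 1))⁻¹ = ((2 : ℝ) ^ k)⁻¹ / 2 := by rw [pow_succ]; field_simp
  have h5 : ((2 : ℝ) ^ (k + 1 + 3))⁻¹ = ((2 : ℝ) ^ k)⁻¹ / 16 := by
    rw [add_assoc, pow_add]; field_simp; norm_num
  rw [h4, h5]
  have : (0 : ℝ) < ((2 : ℝ) ^ k)⁻¹ := by positivity
  linarith

/-! ### Choosing gaps and rewriting coordinates -/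

/-- Among many points one finds two between which an increasing function grows little. -/
theorem exists_lt_sub_le (h : ℕ → ℝ) {H : ℝ} (h0 : ∀ x, 0 ≤ h x) (hH : ∀ x, h x ≤ H) {K : ℕ}
    (hK : 0 < K) {J : Finset ℕ} (hJ : K + 1 ≤ J.card) :
    ∃ m ∈ J, ∃ n ∈ J, m < n ∧ h n - h m ≤ H / K := by
  by_contra! hcon
  -- The weak inequality starts the induction at a singleton; the strict one yields the
  -- contradiction.
  have key : ∀ J' : Finset ℕ, J' ⊆ J → ∀ hne : J'.Nonempty,
      ((J'.card : ℝ) - 1) * (H / K) ≤ h (J'.max' hne) - h (J'.min' hne) ∧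
      (1 < J'.card → ((J'.card : ℝ) - 1) * (H / K) < h (J'.max' hne) - h (J'.min' hne)) := by
    intro J'
    induction J' using Finset.induction_on_max with
    | empty => exact fun _ hne => absurd hne (by simp)
    | insert a s ha ih =>
      intro hsub hne
      have has : a ∉ s := fun hs => lt_irrefl _ (ha a hs)
      rw [Finset.card_insert_of_notMem has]
      rcases s.eq_empty_or_nonempty with rfl | hs
      · simp
      · obtain ⟨ih, -⟩ := ih ((Finset.subset_insert a s).trans hsub) hs
        have hmax : (insert a s).max' hne = a :=
          le_antisymm (Finset.max'_le _ _ _ fun y hy => by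
            rcases Finset.mem_insert.mp hy with rfl | hy
            · exact le_rfl
            · exact (ha y hy).le) (Finset.le_max' _ _ (Finset.mem_insert_self _ _))
        have hmin : (insert a s).min' hne = s.min' hs :=
          le_antisymm (Finset.min'_le _ _ (Finset.mem_insert_of_mem (s.min'_mem hs)))
            (Finset.le_min' _ _ _ fun y hy => by
              rcases Finset.mem_insert.mp hy with rfl | hy
              · exact (ha _ (s.min'_mem hs)).le
              · exact s.min'_le y hy)
        have hstep := hcon (s.max' hs) (hsub (Finset.mem_insert_of_mem (s.max'_mem hs))) a
          (hsub (Finset.mem_insert_self _ _)) (ha _ (s.max'_mem hs))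
        rw [hmax, hmin]
        push_cast
        have : ((s.card : ℝ) + 1 - 1) * (H / K) = (s.card - 1) * (H / K) + H / K := by ring
        rw [this]
        exact ⟨by linarith, fun _ => by linarith⟩
  have hne : J.Nonempty := Finset.card_pos.mp (by omega)
  have hk := (key J subset_rfl hne).2 (by omega)
  have hKR : (0 : ℝ) < K := by exact_mod_cast hK
  have hc : (K : ℝ) ≤ J.card - 1 := by
    have : ((K + 1 : ℕ) : ℝ) ≤ J.card := by exact_mod_cast hJ
    push_cast at this; linarith
  have hHn : 0 ≤ H / K := div_nonneg ((h0 0).trans (hH 0)) hKR.le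
  have h1 : H ≤ ((J.card : ℝ) - 1) * (H / K) :=
    calc H = K * (H / K) := by field_simp
      _ ≤ _ := mul_le_mul_of_nonneg_right hc hHn
  linarith [hH (J.max' hne), h0 (J.min' hne)]

theorem one_le_growth (k : ℕ) : 1 ≤ growth k := by
  have h2 := two_div_pow_le k
  have h3 : (0 : ℝ) ≤ 2 / 2 ^ (k + 7) := by positivity
  refine Real.one_le_rpow ?_ (expo_pos _).le
  rw [one_le_inv₀ (by linarith)]
  linarith

/-- The map `Φ` changes no coordinate outside `[m, n)`. -/
def FixesOutside (m n : ℕ) (Φ : Pt → Pt) : Prop := ∀ z i, i < m ∨ n ≤ i → Φ z i = z i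

/-- A choice of an extension of each prefix of length `m` yields a causal map. -/
theorem exists_causal_fill (m n : ℕ) {P : Pt → Prop} (h : ∀ a, ∃ z, P (splice m a z)) :
    ∃ Φ : Pt → Pt, Causal Φ ∧ FixesOutside m n Φ ∧ ∀ a, ∃ y, P y ∧ AgreeBelow n (Φ a) y := by
  choose g hg using h
  -- Zeroing the tail before choosing makes the choice depend on the prefix alone, whence causality.
  let o : Pt := fun _ => 0
  let ext : Pt → Pt := fun a => splice m (splice m a o) (g (splice m a o))
  have hext : ∀ x y, AgreeBelow m x y → ext x = ext y := by
    intro x y hxy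
    have : splice m x o = splice m y o := by
      funext i
      rcases lt_or_ge i m with hi | hi
      · rw [splice_of_lt hi, splice_of_lt hi, hxy i hi]
      · rw [splice_of_le hi, splice_of_le hi]
    simp only [ext, this]
  refine ⟨fun a i => if m ≤ i ∧ i < n then ext a i else a i, ?_, ?_, ?_⟩
  · intro N x y hxy i hi
    dsimp only
    split_ifs with hmi
    · rw [hext x y (hxy.mono (hmi.1.trans hi.le))]
    · exact hxy i hi
  · intro z i hi
    exact if_neg (by omega)
  · intro a
    refine ⟨ext a, hg _, fun i hi => ?_⟩
    dsimp only
    split_ifs with hmi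
    · rfl
    · have him : i < m := by omega
      simp only [ext]
      rw [splice_of_lt him, splice_of_lt him]

/-- The indices left after the coordinates in `[m, n)` have been changed. -/
def removeGap (I : Finset ℕ) (m n : ℕ) : Finset ℕ :=
  I.filter fun i => n ≤ i ∨ ∃ j ∈ I, i < j ∧ j < m

theorem removeGap_subset (I : Finset ℕ) (m n : ℕ) : removeGap I m n ⊆ I :=
  Finset.filter_subset _ _

theorem card_le_card_removeGap (I : Finset ℕ) (m n : ℕ) :
    I.card ≤ (removeGap I m n).card + (I.filter fun i => m ≤ i ∧ i < n).card + 1 := by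
  have hsub : I ⊆ (removeGap I m n ∪ I.filter fun i => m ≤ i ∧ i < n) ∪
      I.filter fun i => i < m ∧ ∀ j ∈ I, j < m → j ≤ i := by
    intro i hi
    simp only [removeGap, Finset.mem_union, Finset.mem_filter, hi, true_and]
    rcases le_or_gt n i with hn | hn
    · exact Or.inl (Or.inl (Or.inl hn))
    · rcases le_or_gt m i with hm | hm
      · exact Or.inl (Or.inr ⟨hm, hn⟩)
      · by_cases hj : ∃ j ∈ I, i < j ∧ j < m
        · exact Or.inl (Or.inl (Or.inr hj))
        · push Not at hj
          exact Or.inr ⟨hm, fun j hjI hjm => not_lt.mp fun hij => absurd hjm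
            (not_lt.mpr (hj j hjI hij))⟩
  have h1 : (I.filter fun i => i < m ∧ ∀ j ∈ I, j < m → j ≤ i).card ≤ 1 := by
    refine Finset.card_le_one.mpr fun a ha b hb => ?_
    obtain ⟨ha, ham, ha'⟩ := Finset.mem_filter.mp ha
    obtain ⟨hb, hbm, hb'⟩ := Finset.mem_filter.mp hb
    exact le_antisymm (hb' a ha ham) (ha' b hb hbm)
  calc I.card ≤ _ := Finset.card_le_card hsub
    _ ≤ _ := (Finset.card_union_le _ _).trans (Nat.add_le_add (Finset.card_union_le _ _) h1)

/-- For an index below `m` the next one may lie beyond the gap, and thinness up to it need not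
survive. Retaining only indices followed by some `j < m` lets `j` end the unchanged interval; this
is why the largest index below `m` is given up. -/
theorem FixesOutside.removeGap {m n : ℕ} {Φ : Pt → Pt} (h : FixesOutside m n Φ)
    (I : Finset ℕ) : ∀ x ∈ removeGap I m n, ∀ y ∈ removeGap I m n, x < y →
      ∃ y' ∈ I, x < y' ∧ y' ≤ y ∧ FixesBetween x y' Φ := by
  intro x hx y hy hxy
  have hyI := removeGap_subset I m n hy
  rcases (Finset.mem_filter.mp hx).2 with hnx | ⟨j, hj, hxj, hjm⟩
  · exact ⟨y, hyI, hxy, le_rfl, fun z i hi _ => h z i (Or.inr (hnx.trans hi))⟩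
  · rcases le_total y j with hyj | hjy
    · exact ⟨y, hyI, hxy, le_rfl, fun z i _ hi => h z i (Or.inl (by omega))⟩
    · exact ⟨j, hj, hxj, hjy, fun z i _ hi => h z i (Or.inl (by omega))⟩

theorem Stable.preimage_removeGap {C : Set Mark} (hC : Stable C) {e : Mark} (he : e ∈ C)
    {m n : ℕ} {Φ : Pt → Pt} (hΦ : Causal Φ) (hf : FixesOutside m n Φ)
    (hne : (removeGap e.idx m n).Nonempty) :
    (⟨Φ ⁻¹' e.set, removeGap e.idx m n, e.rank⟩ : Mark) ∈ C :=
  hC.preimage e he Φ hΦ _ (removeGap_subset _ _ _) hne (hf.removeGap _)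

theorem Stable.preimage_splice {C : Set Mark} (hC : Stable C) {e : Mark} (he : e ∈ C)
    (m : ℕ) (a : Pt) (hne : (e.idx.filter (m ≤ ·)).Nonempty) :
    (⟨splice m a ⁻¹' e.set, e.idx.filter (m ≤ ·), e.rank⟩ : Mark) ∈ C :=
  hC.preimage e he _ (causal_splice m a) _ (Finset.filter_subset _ _) hne fun _ hx y hy hxy =>
    ⟨y, (Finset.mem_filter.mp hy).1, hxy, le_rfl, fun _ _ hi _ =>
      splice_of_le ((Finset.mem_filter.mp hx).2.trans hi) _ _⟩

/-- In a thin set one may avoid, in addition to the set itself, marks of small total weight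
which have sufficiently many indices in the given interval. -/
theorem Thin.exists_notMem_hull {C : Set Mark} (hC : Stable C) {m n k : ℕ} (hmn : m ≤ n)
    {X : Set Pt}
    (hX : Thin C m n X) (hr : ∀ e ∈ C, k + 1 ≤ e.rank) {ι : Type*} (F : Finset ι) (g : ι → Mark)
    (hF : ∀ f ∈ F, g f ∈ C)
    (hidx : ∀ f ∈ F, ((g f).idx.card : ℝ) ≤
      2 ^ (k + 7) * ((g f).idx.filter fun i => m ≤ i ∧ i < n).card)
    (hw : 2 * ∑ f ∈ F, (g f).wt < 1) (a : Pt) :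
    ∃ z, splice m a z ∉ hull n X ∧ ∀ f ∈ F, splice m a z ∉ hull n (g f).set := by
  have hfil : ∀ f, ((g f).idx.filter (m ≤ ·)).filter (· < n) =
      (g f).idx.filter fun i => m ≤ i ∧ i < n := fun f => Finset.filter_filter _ _ _
  have hpos : ∀ f ∈ F, 0 < (g f).idx.card := fun f hf =>
    Finset.card_pos.mpr (hC.idx_nonempty _ (hF f hf))
  have hne : ∀ f ∈ F, ((g f).idx.filter fun i => m ≤ i ∧ i < n).Nonempty := by
    intro f hf
    rw [Finset.nonempty_iff_ne_empty]
    intro h0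
    have h1 := hidx f hf
    rw [h0, Finset.card_empty, Nat.cast_zero, mul_zero] at h1
    have h2 : (0 : ℝ) < (g f).idx.card := by exact_mod_cast hpos f hf
    linarith
  -- Keeping only the indices in `[m, n)` allows the prefix to be fixed and the `n`-hull to be
  -- taken; by `hidx` the weight at most doubles.
  let g' : ι → Mark := fun f =>
    ⟨hull n (splice m a ⁻¹' (g f).set), ((g f).idx.filter (m ≤ ·)).filter (· < n), (g f).rank⟩
  have hg' : ∀ f ∈ F, g' f ∈ C := by
    intro f hf
    refine hC.hull _ (hC.preimage_splice (hF f hf) m a ?_) n ?_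
    · exact (hne f hf).mono fun i hi => by
        obtain ⟨hi, hm, -⟩ := Finset.mem_filter.mp hi
        exact Finset.mem_filter.mpr ⟨hi, hm⟩
    · change (((g f).idx.filter (m ≤ ·)).filter (· < n)).Nonempty
      rw [hfil]; exact hne f hf
  have hsum : ∑ f ∈ F, (g' f).wt < 1 := by
    refine lt_of_le_of_lt ?_ hw
    rw [Finset.mul_sum]
    refine Finset.sum_le_sum fun f hf => ?_
    have hk : k + 7 ≤ 2 ^ ((g f).rank + 3) := by
      have h1 := hr _ (hF f hf)
      calc k + 7 ≤ 8 * (k + 1) := by omega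
        _ ≤ 8 * 2 ^ (k + 1) := Nat.mul_le_mul_left _ Nat.lt_two_pow_self.le
        _ ≤ 8 * 2 ^ (g f).rank := by gcongr; norm_num
        _ = _ := by rw [pow_add]; ring
    refine weight_le_two_mul_of_pow hk (hpos f hf) ?_
    simp only [g']
    rw [hfil]
    exact hidx f hf
  obtain ⟨z, hz, hz'⟩ := (hX a).exists_notMem F g' hg' hsum
  refine ⟨z, hz, fun f hf => ?_⟩
  rintro ⟨y, hy, hyz⟩
  refine hz' f hf ⟨splice m z y, ?_, ?_⟩
  · rw [Set.mem_preimage, splice_splice, splice_eq_self]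
    · exact hy
    · exact (hyz.mono hmn).trans (agreeBelow_splice m a z)
  · intro i hi
    rcases lt_or_ge i m with him | him
    · rw [splice_of_lt him]
    · rw [splice_of_le him, hyz i hi, splice_of_le him]

/-- Between two of sufficiently many points, the marks having a fixed proportion of their
indices there have small weight. -/
theorem exists_gap {ι : Type*} (F : Finset ι) (g : ι → Mark)
    (hne : ∀ f ∈ F, (g f).idx.Nonempty) {W θ : ℝ} (hW : ∑ f ∈ F, (g f).wt ≤ W) (hθ : 0 < θ)
    {K : ℕ} (hK : 0 < K) {J : Finset ℕ} (hJ : K + 1 ≤ J.card) :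
    ∃ m ∈ J, ∃ n ∈ J, m < n ∧
      ∑ f ∈ F with ((g f).idx.card : ℝ) ≤ θ * ((g f).idx.filter fun i => m ≤ i ∧ i < n).card,
        (g f).wt ≤ θ * W / K := by
  classical
  -- The sum of the `v f x` weighs the proportion of indices below `x`; it lies between 0 and `W`,
  -- so it grows little between two points of `J`.
  let v : ι → ℕ → ℝ := fun f x => (g f).wt * (((g f).idx.filter (· < x)).card / (g f).idx.card)
  have hpos : ∀ f ∈ F, (0 : ℝ) < (g f).idx.card := fun f hf => by
    exact_mod_cast Finset.card_pos.mpr (hne f hf)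
  obtain ⟨m, hm, n, hn, hmn, hle⟩ := exists_lt_sub_le (fun x => ∑ f ∈ F, v f x) (H := W)
    (fun x => Finset.sum_nonneg fun f _ => mul_nonneg (g f).wt_nonneg (by positivity))
    (fun x => (Finset.sum_le_sum fun f hf => by
      refine mul_le_of_le_one_right (g f).wt_nonneg ?_
      rw [div_le_one (hpos f hf)]
      exact_mod_cast Finset.card_le_card (Finset.filter_subset _ _)).trans hW) hK hJ
  refine ⟨m, hm, n, hn, hmn, ?_⟩
  rw [mul_div_assoc]
  refine le_trans ?_ (mul_le_mul_of_nonneg_left hle hθ.le)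
  rw [← Finset.sum_sub_distrib, Finset.mul_sum]
  have hdiff : ∀ f ∈ F, θ * (v f n - v f m) = (g f).wt *
      (θ * ((g f).idx.filter fun i => m ≤ i ∧ i < n).card / (g f).idx.card) := by
    intro f hf
    have hc : ((g f).idx.filter (· < n)).card = ((g f).idx.filter (· < m)).card +
        ((g f).idx.filter fun i => m ≤ i ∧ i < n).card := by
      rw [← Finset.card_union_of_disjoint]
      · congr 1
        ext i
        simp only [Finset.mem_filter, Finset.mem_union]
        constructor
        · rintro ⟨hi, hin⟩
          rcases lt_or_ge i m with h | h
          · exact Or.inl ⟨hi, h⟩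
          · exact Or.inr ⟨hi, h, hin⟩
        · rintro (⟨hi, h⟩ | ⟨hi, -, h⟩)
          · exact ⟨hi, h.trans hmn⟩
          · exact ⟨hi, h⟩
      · rw [Finset.disjoint_left]
        intro i hi hi'
        have h1 := (Finset.mem_filter.mp hi).2
        have h2 := (Finset.mem_filter.mp hi').2.1
        omega
    simp only [v]
    rw [hc]
    push_cast
    have := (hpos f hf).ne'
    field_simp
    ring
  rw [Finset.sum_congr rfl hdiff]
  refine (Finset.sum_le_sum fun f hf => ?_).trans
    (Finset.sum_le_sum_of_subset_of_nonneg (Finset.filter_subset _ _) fun f hf _ =>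
      mul_nonneg (g f).wt_nonneg (by positivity))
  obtain ⟨hf, hle⟩ := Finset.mem_filter.mp hf
  refine le_mul_of_one_le_right (g f).wt_nonneg ?_
  rwa [one_le_div (hpos f hf)]

/-- Among finitely many sets with many elements beyond `b` there is one that has `t` elements in
an interval `[b, q)` such that each of the others has all but `t` of its elements beyond `q`. -/
theorem exists_first {ι : Type*} {G : Finset ι} (hG : G.Nonempty) (I : ι → Finset ℕ) {b s t : ℕ}
    (ht : 0 < t) (h : ∀ g ∈ G, (s + 1) * t ≤ ((I g).filter (b ≤ ·)).card) :
    ∃ e ∈ G, ∃ q, t ≤ ((I e).filter fun i => b ≤ i ∧ i < q).card ∧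
      ∀ g ∈ G, s * t ≤ ((I g).filter (q ≤ ·)).card := by
  classical
  have hex : ∃ q, ∃ e ∈ G, t ≤ ((I e).filter fun i => b ≤ i ∧ i < q).card := by
    obtain ⟨e, he⟩ := hG
    refine ⟨(I e).sup id + 1, e, he, ?_⟩
    have h1 : (I e).filter (fun i => b ≤ i ∧ i < (I e).sup id + 1) = (I e).filter (b ≤ ·) := by
      refine Finset.filter_congr fun i hi => ?_
      have : i ≤ (I e).sup id := Finset.le_sup (f := id) hi
      constructor
      · exact fun h => h.1
      · exact fun h => ⟨h, by omega⟩
    rw [h1]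
    exact (Nat.le_mul_of_pos_left t (Nat.succ_pos s)).trans (h e he)
  obtain ⟨e, he, hq⟩ := Nat.find_spec hex
  refine ⟨e, he, Nat.find hex, hq, fun g hg => ?_⟩
  set q := Nat.find hex with hqdef
  have hq0 : q ≠ 0 := by
    intro h0
    rw [h0] at hq
    simp only [Nat.not_lt_zero, and_false, Finset.filter_false, Finset.card_empty] at hq
    omega
  -- Minimality of `q`: each set has fewer than `t` elements in `[b, q - 1)`, hence at most `t` in
  -- `[b, q)`.
  have hlt : ((I g).filter fun i => b ≤ i ∧ i < q - 1).card < t := by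
    have := Nat.find_min hex (m := q - 1) (by omega)
    push Not at this
    exact this g hg
  have hsub : (I g).filter (b ≤ ·) ⊆ ((I g).filter fun i => b ≤ i ∧ i < q - 1) ∪ {q - 1} ∪
      (I g).filter (q ≤ ·) := by
    intro i hi
    obtain ⟨hi, hbi⟩ := Finset.mem_filter.mp hi
    simp only [Finset.mem_union, Finset.mem_filter, Finset.mem_singleton, hi, true_and, hbi]
    omega
  have h1 := Finset.card_le_card hsub
  have h2 := Finset.card_union_le (((I g).filter fun i => b ≤ i ∧ i < q - 1) ∪ {q - 1})
    ((I g).filter (q ≤ ·))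
  have h3 := Finset.card_union_le ((I g).filter fun i => b ≤ i ∧ i < q - 1) {q - 1}
  rw [Finset.card_singleton] at h3
  have h4 := h g hg
  rw [Nat.succ_mul] at h4
  omega

/-! ### The lower bound for covers of the whole space -/

/-- Finitely many thin sets with sufficiently many indices, together with marks of higher rank
of small total weight, do not cover the space. -/
theorem exists_avoiding {C : Set Mark} {k : ℕ} (hC : Stable C) (hr : ∀ e ∈ C, k + 1 ≤ e.rank)
    {c : ℝ} (hc : c ≤ 32) (hH : Heavy C c Set.univ) {ι κ : Type*} (I : ι → Finset ℕ) (s : ℕ) :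
    ∀ (G : Finset ι) (_ : G.card = s) (b : ℕ) (E : ι → Set Pt)
      (_ : ∀ g ∈ G, s * (2 ^ (k + 13) + 1) ≤ ((I g).filter (b ≤ ·)).card)
      (_ : ∀ g ∈ G, ∀ m ∈ I g, b ≤ m → ∀ n ∈ I g, m < n → Thin C m n (E g))
      (F : Finset κ) (φ : κ → Mark) (_ : ∀ f ∈ F, φ f ∈ C)
      (_ : growth k ^ s * ∑ f ∈ F, (φ f).wt < c),
      ∃ z, (∀ g ∈ G, z ∉ E g) ∧ ∀ f ∈ F, z ∉ (φ f).set := by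
  classical
  induction s with
  | zero =>
    intro G hG b E _ _ F φ hF hw
    rw [pow_zero, one_mul] at hw
    obtain ⟨z, -, hz⟩ := hH.exists_notMem F φ hF hw
    rw [Finset.card_eq_zero] at hG
    exact ⟨z, by simp [hG], hz⟩
  | succ s ih =>
    intro G hG b E hcard hthin F φ hF hw
    have hg1 := one_le_growth k
    have hW0 : 0 ≤ ∑ f ∈ F, (φ f).wt := Finset.sum_nonneg fun f _ => (φ f).wt_nonneg
    have hWlt : ∑ f ∈ F, (φ f).wt < 32 :=
      (le_mul_of_one_le_left hW0 (one_le_pow₀ hg1)).trans_lt (hw.trans_le hc)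
    have hwt : ∀ f ∈ F, (φ f).wt < 32 := fun f hf =>
      (Finset.single_le_sum (fun f _ => (φ f).wt_nonneg) hf).trans_lt hWlt
    have hpos : ∀ f ∈ F, 0 < (φ f).idx.card := fun f hf =>
      Finset.card_pos.mpr (hC.idx_nonempty _ (hF f hf))
    obtain ⟨e, he, q, hJ, hq⟩ := exists_first (Finset.card_pos.mp (by omega)) I
      (Nat.succ_pos (2 ^ (k + 13))) hcard
    obtain ⟨m, hm, n, hn, hmn, hgap⟩ := exists_gap F φ
      (fun f hf => Finset.card_pos.mp (hpos f hf)) le_rfl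
      (θ := 2 ^ (k + 7)) (by positivity) (K := 2 ^ (k + 13)) (by positivity) hJ
    obtain ⟨hmI, hbm, -⟩ := Finset.mem_filter.mp hm
    obtain ⟨hnI, -, hnq⟩ := Finset.mem_filter.mp hn
    -- These marks would lose too many indices with the gap, so they are avoided inside it, together
    -- with `E e`.
    set L := F.filter fun f => ((φ f).idx.card : ℝ) ≤
      2 ^ (k + 7) * ((φ f).idx.filter fun i => m ≤ i ∧ i < n).card with hL
    have hLw : 2 * ∑ f ∈ L, (φ f).wt < 1 := by
      -- The quotient of the powers is `1/64` and the total weight is below 32.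
      have h1 : (2 : ℝ) ^ (k + 7) * (∑ f ∈ F, (φ f).wt) / ((2 ^ (k + 13) : ℕ) : ℝ) < 1 / 2 := by
        push_cast
        rw [div_lt_div_iff₀ (by positivity) (by norm_num)]
        have h2 : (2 : ℝ) ^ (k + 13) = 2 ^ (k + 7) * 64 := by
          rw [pow_add, pow_add]; norm_num; ring
        have h3 : (0 : ℝ) < 2 ^ (k + 7) := by positivity
        rw [h2]
        nlinarith
      linarith
    obtain ⟨Φ, hΦ, hΦo, hΦa⟩ := exists_causal_fill m n
      (P := fun y => y ∉ hull n (E e) ∧ ∀ f ∈ L, y ∉ hull n (φ f).set)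
      ((hthin e he m hmI hbm n hnI hmn).exists_notMem_hull hC hmn.le hr L φ
        (fun f hf => hF f (Finset.mem_filter.mp hf).1)
        (fun f hf => (Finset.mem_filter.mp hf).2) hLw)
    -- One share `2^(-(k+7))` pays for the indices in the gap; the other pays for the one extra
    -- index, since weight below 32 forces at least `2^(k+7)` indices.
    have hrem : ∀ f ∈ F \ L, (1 - 2 / 2 ^ (k + 7)) * ((φ f).idx.card : ℝ) ≤
        (removeGap (φ f).idx m n).card := by
      intro f hf
      obtain ⟨hf, hfL⟩ := Finset.mem_sdiff.mp hf
      have h1 : (2 : ℝ) ^ (k + 7) * ((φ f).idx.filter fun i => m ≤ i ∧ i < n).card ≤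
          (φ f).idx.card := by
        by_contra! hcon
        exact hfL (Finset.mem_filter.mpr ⟨hf, hcon.le⟩)
      have h2 : (2 : ℝ) ^ (k + 7) ≤ (φ f).idx.card := by
        have := le_card_of_weight_lt (hpos f hf) (hwt f hf)
        have hk := hr _ (hF f hf)
        have h3 : 2 ^ (k + 7) ≤ 2 ^ (2 * (φ f).rank + 20) :=
          Nat.pow_le_pow_right (by norm_num) (by omega)
        exact_mod_cast h3.trans this
      have h3 : ((φ f).idx.card : ℝ) ≤ (removeGap (φ f).idx m n).card +
          ((φ f).idx.filter fun i => m ≤ i ∧ i < n).card + 1 := by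
        exact_mod_cast card_le_card_removeGap (φ f).idx m n
      have hp : (0 : ℝ) < 2 ^ (k + 7) := by positivity
      have h4 : ((φ f).idx.filter fun i => m ≤ i ∧ i < n).card ≤
          ((φ f).idx.card : ℝ) / 2 ^ (k + 7) := by
        rw [le_div_iff₀ hp]; linarith
      have h5 : (1 : ℝ) ≤ (φ f).idx.card / 2 ^ (k + 7) := by rwa [one_le_div hp]
      have h6 : (1 - 2 / 2 ^ (k + 7)) * ((φ f).idx.card : ℝ) =
          (φ f).idx.card - 2 * ((φ f).idx.card / 2 ^ (k + 7)) := by ring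
      rw [h6]; linarith
    let φ' : κ → Mark := fun f => ⟨Φ ⁻¹' (φ f).set, removeGap (φ f).idx m n, (φ f).rank⟩
    have hφ' : ∀ f ∈ F \ L, φ' f ∈ C := by
      intro f hf
      have hfF := (Finset.mem_sdiff.mp hf).1
      refine hC.preimage_removeGap (hF f hfF) hΦ hΦo (Finset.card_pos.mp ?_)
      have h1 : (0 : ℝ) < (φ f).idx.card := by exact_mod_cast hpos f hfF
      have h2 := two_div_pow_le k
      have h3 : (0 : ℝ) < (1 - 2 / 2 ^ (k + 7)) * ((φ f).idx.card : ℝ) :=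
        mul_pos (by linarith) h1
      exact_mod_cast h3.trans_le (hrem f hf)
    have hw' : growth k ^ s * ∑ f ∈ F \ L, (φ' f).wt < c := by
      refine lt_of_le_of_lt ?_ hw
      rw [pow_succ, mul_assoc]
      refine mul_le_mul_of_nonneg_left ?_ (pow_nonneg (growth_nonneg k) s)
      rw [Finset.mul_sum]
      refine (Finset.sum_le_sum fun f hf => ?_).trans
        (Finset.sum_le_sum_of_subset_of_nonneg Finset.sdiff_subset fun f _ _ =>
          mul_nonneg (growth_nonneg k) (φ f).wt_nonneg)
      have hfF := (Finset.mem_sdiff.mp hf).1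
      exact weight_le_growth_mul (hr (φ f) (hF f hfF)) (hpos f hfF) (hrem f hf)
    -- The remaining sets use only indices from `q > n` on, where `Φ` is the identity, so their
    -- preimages stay thin.
    obtain ⟨z, hzG, hzF⟩ := ih (G.erase e) (by rw [Finset.card_erase_of_mem he, hG]; rfl) q
      (fun g => Φ ⁻¹' E g) (fun g hg => hq g (Finset.mem_of_mem_erase hg))
      (fun g hg x hx hqx y hy hxy =>
        (hthin g (Finset.mem_of_mem_erase hg) x hx (by omega) y hy hxy).preimage hΦ
          fun z i hi _ => hΦo z i (Or.inr (by omega)))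
      (F \ L) φ' hφ' hw'
    obtain ⟨y, ⟨hye, hyL⟩, hzy⟩ := hΦa z
    refine ⟨Φ z, fun g hg => ?_, fun f hf => ?_⟩
    · by_cases hge : g = e
      · rw [hge]
        exact fun h => hye ⟨_, h, hzy⟩
      · exact hzG g (Finset.mem_erase.mpr ⟨hge, hg⟩)
    · by_cases hfL : f ∈ L
      · exact fun h => hyL f hfL ⟨_, h, hzy⟩
      · exact hzF f (Finset.mem_sdiff.mpr ⟨hf, hfL⟩)

/-- The covers of the whole space by marks of rank at least `k` have weight at least
`bound k`. -/
theorem heavy_univ_cls (d k : ℕ) : Heavy (cls d k) (bound k) Set.univ := by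
  classical
  induction d generalizing k with
  | zero =>
    intro F hF hc
    obtain ⟨e, he, -⟩ := hc 0 trivial
    exact absurd (hF e he) (by simp [cls])
  | succ d ih =>
    intro F hF hcov
    by_contra! hlt
    have hwt : ∀ f ∈ F, f.wt < 32 := fun f hf =>
      (Finset.single_le_sum (fun f _ => f.wt_nonneg) hf).trans_lt (hlt.trans (bound_lt k))
    set G := F.filter (· ∈ layer (cls d (k + 1)) k) with hG
    set F' := F.filter (· ∉ layer (cls d (k + 1)) k) with hF'
    have hF'C : ∀ f ∈ F', f ∈ cls d (k + 1) := fun f hf =>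
      (hF f (Finset.mem_filter.mp hf).1).resolve_right (Finset.mem_filter.mp hf).2
    have hGs : G.card ≤ 2 ^ (k + 5) := by
      have h1 : (G.card : ℝ) * ((2 : ℝ) ^ k)⁻¹ ≤ 32 := by
        rw [← nsmul_eq_mul]
        refine (Finset.card_nsmul_le_sum G Mark.wt _ fun f hf => ?_).trans
          ((Finset.sum_le_sum_of_subset_of_nonneg (Finset.filter_subset _ _) fun f _ _ =>
            f.wt_nonneg).trans (hlt.trans (bound_lt k)).le)
        obtain ⟨-, hr, hne, hcard, -⟩ := Finset.mem_filter.mp hf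
        rw [Mark.wt, hr]
        exact le_weight (Finset.card_pos.mpr hne) hcard
      rw [← div_eq_mul_inv, div_le_iff₀ (by positivity)] at h1
      have h2 : (G.card : ℝ) ≤ ((2 ^ (k + 5) : ℕ) : ℝ) := by
        push_cast
        rw [pow_add]
        linarith
      exact_mod_cast h2
    -- Each round uses up at most `2^(k+13) + 1` indices of every mark; the first factor of `maxCard
    -- k` leaves room for `2^(k+5)` rounds.
    have hcard : ∀ g ∈ G, G.card * (2 ^ (k + 13) + 1) ≤ (g.idx.filter (0 ≤ ·)).card := by
      intro g hg
      obtain ⟨hgF, hr, hne, -, -⟩ := Finset.mem_filter.mp hg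
      have h1 := le_card_of_weight_lt (Finset.card_pos.mpr hne) (hwt g hgF)
      rw [hr] at h1
      simp only [Nat.zero_le, Finset.filter_true]
      refine le_trans ?_ h1
      calc G.card * (2 ^ (k + 13) + 1) ≤ 2 ^ (k + 5) * 2 ^ (k + 14) := by
            refine Nat.mul_le_mul hGs ?_
            have : 1 ≤ 2 ^ (k + 13) := Nat.one_le_two_pow
            rw [pow_succ 2 (k + 13)]; omega
        _ = 2 ^ (2 * k + 19) := by rw [← pow_add]; congr 1; ring
        _ ≤ 2 ^ (2 * k + 20) := Nat.pow_le_pow_right (by norm_num) (by omega)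
    have hw : growth k ^ G.card * ∑ f ∈ F', (id f).wt < bound (k + 1) := by
      have h1 : ∑ f ∈ F', f.wt < bound k :=
        (Finset.sum_le_sum_of_subset_of_nonneg (Finset.filter_subset _ _) fun f _ _ =>
          f.wt_nonneg).trans_lt hlt
      exact (mul_lt_mul_of_pos_left h1 (pow_pos (zero_lt_one.trans_le (one_le_growth k)) _)).trans_le
        (growth_pow_mul_bound_le hGs)
    obtain ⟨z, hzG, hzF⟩ := exists_avoiding (stable_cls d (k + 1))
      (fun e he => le_rank_of_mem_cls he) (bound_lt (k + 1)).le (ih (k + 1)) Mark.idx G.card G rfl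
      0 Mark.set hcard
      (fun g hg m hm _ n hn hmn => (Finset.mem_filter.mp hg).2.2.2.2 m hm n hn hmn) F' id hF'C hw
    obtain ⟨e, he, hze⟩ := hcov z trivial
    by_cases heL : e ∈ layer (cls d (k + 1)) k
    · exact hzG e (Finset.mem_filter.mpr ⟨he, heL⟩) hze
    · exact hzF e (Finset.mem_filter.mpr ⟨he, heL⟩) hze

/-! ### Truncating covers at a level -/

theorem Heavy.mono {C C' : Set Mark} {c c' : ℝ} {S : Set Pt} (h : Heavy C c S) (hc : c' ≤ c)
    (hC : C' ⊆ C) : Heavy C' c' S :=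
  fun F hF hcov => hc.trans (h F (fun e he => hC (hF e he)) hcov)

theorem heavy_sixteen_univ (d k : ℕ) : Heavy (cls d k) 16 Set.univ :=
  (heavy_univ_cls d k).mono (le_bound k) subset_rfl

theorem exists_half_below (e : Mark) : ∃ n, e.idx.card ≤ 2 * (e.idx.filter (· < n)).card := by
  refine ⟨e.idx.sup id + 1, ?_⟩
  rw [Finset.filter_true_of_mem]
  · omega
  · intro i hi
    have : i ≤ e.idx.sup id := Finset.le_sup (f := id) hi
    omega

/-- The first level below which there are at least half of the indices. -/
noncomputable def Mark.level (e : Mark) : ℕ := Nat.find (exists_half_below e)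

theorem Mark.card_le_two_mul (e : Mark) :
    e.idx.card ≤ 2 * (e.idx.filter (· < e.level)).card := Nat.find_spec (exists_half_below e)

theorem Mark.lt_of_lt_level {e : Mark} {m : ℕ} (h : m < e.level) :
    2 * (e.idx.filter (· < m)).card < e.idx.card :=
  not_le.mp (Nat.find_min (exists_half_below e) h)

/-- The mark with only those indices below its level, and the corresponding hull. -/
noncomputable def Mark.trunc (e : Mark) : Mark :=
  ⟨hull e.level e.set, e.idx.filter (· < e.level), e.rank⟩

/-- The mark above an atom of level `m`. -/
def Mark.above (e : Mark) (m : ℕ) (x : Pt) : Mark :=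
  ⟨splice m x ⁻¹' e.set, e.idx.filter (m ≤ ·), e.rank⟩

/-- At least half of the indices lie below the level, and for any `m` smaller than the level more
than half lie at or above `m`. So both `trunc` and such an `above` at most double the weight. -/
theorem Mark.wt_trunc_le {e : Mark} (he : e.idx.Nonempty) : e.trunc.wt ≤ 2 * e.wt :=
  weight_le_two_mul (Finset.card_pos.mpr he) e.card_le_two_mul

theorem Mark.card_le_two_mul_above {e : Mark} {m : ℕ} (h : m < e.level) :
    e.idx.card ≤ 2 * (e.idx.filter (m ≤ ·)).card := by
  have h1 := e.lt_of_lt_level h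
  have h2 := Finset.card_filter_add_card_filter_not (s := e.idx) (· < m)
  simp only [not_lt] at h2
  omega

theorem Mark.wt_above_le {e : Mark} (he : e.idx.Nonempty) {m : ℕ} (h : m < e.level) (x : Pt) :
    (e.above m x).wt ≤ 2 * e.wt :=
  weight_le_two_mul (Finset.card_pos.mpr he) (Mark.card_le_two_mul_above h)

theorem Stable.trunc_mem {C : Set Mark} (hC : Stable C) {e : Mark} (he : e ∈ C) : e.trunc ∈ C := by
  have h1 := Finset.card_pos.mpr (hC.idx_nonempty e he)
  have h2 := e.card_le_two_mul
  exact hC.hull e he _ (Finset.card_pos.mp (by omega))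

theorem Stable.above_mem {C : Set Mark} (hC : Stable C) {e : Mark} (he : e ∈ C) {m : ℕ}
    (h : m < e.level) (x : Pt) : e.above m x ∈ C := by
  have h1 := Finset.card_pos.mpr (hC.idx_nonempty e he)
  have h2 := Mark.card_le_two_mul_above h
  exact hC.preimage_splice he m x (Finset.card_pos.mp (by omega))

theorem freeBelow_above (e : Mark) (m : ℕ) (x : Pt) : FreeBelow m (e.above m x).set := by
  intro y z hz
  change splice m x (splice m y z) ∈ e.set
  rw [splice_splice]
  exact hz

theorem hull_subset_trunc {e : Mark} {n : ℕ} (h : e.level ≤ n) : hull n e.set ⊆ e.trunc.set :=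
  hull_subset_hull h subset_rfl

theorem sum_filter_wt_le {F : Finset Mark} (q : Mark → Prop) [DecidablePred q] (f : Mark → Mark)
    (hf : ∀ e ∈ F, q e → (f e).wt ≤ 2 * e.wt) :
    ∑ e ∈ F.filter q, (f e).wt ≤ 2 * ∑ e ∈ F, e.wt := by
  rw [Finset.mul_sum]
  refine (Finset.sum_le_sum fun e he => ?_).trans
    (Finset.sum_le_sum_of_subset_of_nonneg (Finset.filter_subset q F) fun e _ _ =>
      mul_nonneg zero_le_two e.wt_nonneg)
  obtain ⟨he, hq⟩ := Finset.mem_filter.mp he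
  exact hf e he hq

theorem sum_image_wt_le [DecidableEq Mark] (F : Finset Mark) (f : Mark → Mark) :
    ∑ e ∈ F.image f, e.wt ≤ ∑ e ∈ F, (f e).wt :=
  Finset.sum_image_le_of_nonneg fun e _ => e.wt_nonneg

/-- A cover by marks can be replaced by a cover that does not depend on the first coordinates. -/
theorem Stable.exists_freeBelow_cover {C : Set Mark} (hC : Stable C) (hH : Heavy C 16 Set.univ)
    {F : Finset Mark} (hF : ∀ e ∈ F, e ∈ C) (hw : ∑ e ∈ F, e.wt < 8) (m : ℕ) :
    ∃ F' : Finset Mark, (∀ e ∈ F', e ∈ C ∧ FreeBelow m e.set) ∧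
      ∑ e ∈ F', e.wt ≤ 2 * ∑ e ∈ F, e.wt ∧
      ∀ S, FreeBelow m S → (∀ z ∈ S, ∃ e ∈ F, z ∈ e.set) → ∀ z ∈ S, ∃ e ∈ F', z ∈ e.set := by
  classical
  have hne : ∀ e ∈ F, e.idx.Nonempty := fun e he => hC.idx_nonempty e (hF e he)
  -- The doubled weight is below 16, so some prefix `x` avoids all marks of level at most `m`; above
  -- it only the other marks can cover.
  obtain ⟨x, -, hx⟩ := hH.exists_notMem (F.filter fun e => e.level ≤ m) Mark.trunc
    (fun e he => hC.trunc_mem (hF e (Finset.mem_filter.mp he).1))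
    ((sum_filter_wt_le _ _ fun e he _ => Mark.wt_trunc_le (hne e he)).trans_lt (by linarith))
  refine ⟨(F.filter fun e => m < e.level).image fun e => e.above m x, ?_, ?_, ?_⟩
  · intro e he
    obtain ⟨e, h, rfl⟩ := Finset.mem_image.mp he
    obtain ⟨he, hm⟩ := Finset.mem_filter.mp h
    exact ⟨hC.above_mem (hF e he) hm x, freeBelow_above e m x⟩
  · exact (sum_image_wt_le _ _).trans
      (sum_filter_wt_le _ _ fun e he hm => Mark.wt_above_le (hne e he) hm x)
  · intro S hS hcov z hz
    obtain ⟨e, he, hze⟩ := hcov _ (hS x z hz)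
    have hm : m < e.level := by
      by_contra! hm
      exact hx e (Finset.mem_filter.mpr ⟨he, hm⟩)
        (hull_subset_trunc hm ⟨_, hze, agreeBelow_splice m x z⟩)
    exact ⟨_, Finset.mem_image_of_mem _ (Finset.mem_filter.mpr ⟨he, hm⟩), hze⟩

/-- A set depending on the first `n` coordinates is covered by the truncated marks of level at
most `n` from a cover. -/
theorem Stable.cover_trunc {C : Set Mark} (hC : Stable C) (hH : Heavy C 16 Set.univ)
    {F : Finset Mark} (hF : ∀ e ∈ F, e ∈ C) (hw : ∑ e ∈ F, e.wt < 8) {n : ℕ} {S : Set Pt}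
    (hS : DependsBelow n S) (hcov : ∀ z ∈ S, ∃ e ∈ F, z ∈ e.set) :
    ∀ z ∈ S, ∃ e ∈ F, e.level ≤ n ∧ z ∈ e.trunc.set := by
  classical
  intro z hz
  by_contra! hcon
  have hne : ∀ e ∈ F, e.idx.Nonempty := fun e he => hC.idx_nonempty e (hF e he)
  -- Above the missed point `z`, marks of level beyond `n` would have to cover the whole atom, for
  -- which they are too light.
  obtain ⟨y, -, hy⟩ := hH.exists_notMem (F.filter fun e => n < e.level) (fun e => e.above n z)
    (fun e he => hC.above_mem (hF e (Finset.mem_filter.mp he).1) (Finset.mem_filter.mp he).2 z)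
    ((sum_filter_wt_le _ _ fun e he hn => Mark.wt_above_le (hne e he) hn z).trans_lt (by linarith))
  obtain ⟨e, he, hye⟩ := hcov _ (hS _ _ (agreeBelow_splice n z y).symm hz)
  rcases le_or_gt e.level n with hn | hn
  · exact hcon e he hn (hull_subset_trunc hn ⟨_, hye, agreeBelow_splice n z y⟩)
  · exact hy e (Finset.mem_filter.mpr ⟨he, hn⟩) hye

/-- The point with the given first coordinates and all others equal to zero. -/
def extend {n : ℕ} (v : ∀ i : Fin n, Fin (i + 1)) : Pt :=
  fun i => if h : i < n then v ⟨i, h⟩ else 0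

theorem agreeBelow_extend (n : ℕ) (x : Pt) :
    AgreeBelow n x (extend fun i : Fin n => x i) :=
  fun i hi => by simp [extend, hi]

theorem finite_dependsBelow (n : ℕ) : {S | DependsBelow n S}.Finite := by
  refine Set.Finite.of_finite_image (f := fun S => (extend (n := n)) ⁻¹' S) (Set.toFinite _) ?_
  have key : ∀ S S', DependsBelow n S → DependsBelow n S' →
      (extend (n := n)) ⁻¹' S = (extend (n := n)) ⁻¹' S' → S ⊆ S' := by
    intro S S' hS hS' h z hz
    have h1 : (fun i : Fin n => z i) ∈ (extend (n := n)) ⁻¹' S := hS _ _ (agreeBelow_extend n z) hz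
    rw [h] at h1
    exact hS' _ _ (agreeBelow_extend n z).symm h1
  exact fun S hS S' hS' h => (key S S' hS hS' h).antisymm (key S' S hS' hS h.symm)

/-- Weight below 32 forces at least `2^(2r+20)` indices at rank `r`, and half of them lie below `n`;
this bounds the rank. -/
theorem finite_trunc (n : ℕ) :
    {e' | ∃ e : Mark, e.idx.Nonempty ∧ e.wt < 32 ∧ e.level ≤ n ∧ e' = e.trunc}.Finite := by
  refine Set.Finite.subset (((finite_dependsBelow n).prod
    (((Finset.range n).powerset.finite_toSet).prod (Set.finite_le_nat (2 * n)))).image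
      fun t => (⟨t.1, t.2.1, t.2.2⟩ : Mark)) ?_
  rintro _ ⟨e, hne, hw, hl, rfl⟩
  have hsub : e.idx.filter (· < e.level) ⊆ Finset.range n := by
    intro i hi
    have := (Finset.mem_filter.mp hi).2
    exact Finset.mem_range.mpr (by omega)
  refine ⟨(hull e.level e.set, e.idx.filter (· < e.level), e.rank),
    ⟨(dependsBelow_hull _ _).mono hl, ?_, ?_⟩, rfl⟩
  · exact Finset.mem_coe.mpr (Finset.mem_powerset.mpr hsub)
  · have h1 := le_card_of_weight_lt (Finset.card_pos.mpr hne) hw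
    have h2 := e.card_le_two_mul
    have h3 := Finset.card_le_card hsub
    rw [Finset.card_range] at h3
    have h4 : e.rank < 2 ^ (2 * e.rank + 20) :=
      (by omega : e.rank < 2 * e.rank + 20).trans Nat.lt_two_pow_self
    change e.rank ≤ 2 * n
    omega

/-! ### The ultrafilter limit of the classes -/

/-- The limit, along an ultrafilter, of the classes of marks of rank from `k` up to `p - 1`. -/
def limCls (k : ℕ) : Set Mark :=
  {e | ∀ᶠ p in (Filter.hyperfilter ℕ : Filter ℕ), e ∈ cls (p - k) k}

theorem eventually_gt_hyperfilter (k : ℕ) : ∀ᶠ p in (Filter.hyperfilter ℕ : Filter ℕ), k < p :=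
  (Filter.eventually_gt_atTop k).filter_mono Nat.hyperfilter_le_atTop

theorem cls_sub {k p : ℕ} (h : k < p) : cls (p - k) k =
    cls (p - (k + 1)) (k + 1) ∪ layer (cls (p - (k + 1)) (k + 1)) k := by
  rw [show p - k = p - (k + 1) + 1 by omega, cls]

theorem limCls_antitone : Antitone limCls := by
  refine antitone_nat_of_succ_le fun k e he => ?_
  filter_upwards [he, eventually_gt_hyperfilter k] with p hp hk
  rw [cls_sub hk]
  exact Or.inl hp

theorem mem_limCls {e : Mark} (hne : e.idx.Nonempty) (hc : e.idx.card ≤ maxCard e.rank)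
    (ht : ∀ᶠ p in (Filter.hyperfilter ℕ : Filter ℕ),
      ThinOn (cls (p - (e.rank + 1)) (e.rank + 1)) e.idx e.set) : e ∈ limCls e.rank := by
  filter_upwards [ht, eventually_gt_hyperfilter e.rank] with p hp hk
  rw [cls_sub hk]
  exact Or.inr ⟨rfl, hne, hc, hp⟩

/-- Light increasing sets are covered by an increasing sequence of finite families of marks. -/
theorem exists_limit_marks (k m : ℕ) {S : ℕ → Set Pt} (hmono : Monotone S) {N : ℕ → ℕ}
    (hdep : ∀ j, DependsBelow (N j) (S j)) (hfree : ∀ j, FreeBelow m (S j))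
    (hlight : ∀ j, ∀ᶠ p in (Filter.hyperfilter ℕ : Filter ℕ), ¬ Heavy (cls (p - k) k) 1 (S j)) :
    ∃ H : ℕ → Finset Mark, Monotone H ∧
      (∀ n, ∀ e ∈ H n, e ∈ limCls k ∧ FreeBelow m e.set ∧ DependsBelow n e.set) ∧
      (∀ n, ∑ e ∈ H n, e.wt ≤ 4) ∧ ∀ j, ∀ z ∈ S j, ∃ e ∈ H (N j), z ∈ e.set := by
  classical
  -- A single cover must serve every light `S j` with `j ≤ p`; by monotonicity a cover of the
  -- largest one does.
  have h1 : ∀ p, ∃ F : Finset Mark, (∀ e ∈ F, e ∈ cls (p - k) k) ∧ ∑ e ∈ F, e.wt ≤ 1 ∧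
      ∀ j ≤ p, ¬ Heavy (cls (p - k) k) 1 (S j) → ∀ z ∈ S j, ∃ e ∈ F, z ∈ e.set := by
    intro p
    by_cases hex : ∃ j ≤ p, ¬ Heavy (cls (p - k) k) 1 (S j)
    · obtain ⟨j, hj, hj'⟩ := hex
      have hspec := Nat.findGreatest_spec (P := fun j => ¬ Heavy (cls (p - k) k) 1 (S j)) hj hj'
      have hle : ∀ i ≤ p, ¬ Heavy (cls (p - k) k) 1 (S i) →
          i ≤ Nat.findGreatest (fun j => ¬ Heavy (cls (p - k) k) 1 (S j)) p :=
        fun i hi hi' => Nat.le_findGreatest hi hi'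
      generalize Nat.findGreatest (fun j => ¬ Heavy (cls (p - k) k) 1 (S j)) p = l at hspec hle
      unfold Heavy at hspec
      push Not at hspec
      obtain ⟨F, hF, hcov, hw⟩ := hspec
      exact ⟨F, hF, hw.le, fun i hi hi' z hz => hcov z (hmono (hle i hi hi') hz)⟩
    · push Not at hex
      exact ⟨∅, by simp, by simp, fun j hj hj' => absurd (hex j hj) hj'⟩
  have h2 : ∀ p, ∃ F : Finset Mark, (∀ e ∈ F, e ∈ cls (p - k) k ∧ FreeBelow m e.set) ∧
      ∑ e ∈ F, e.wt ≤ 2 ∧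
      ∀ j ≤ p, ¬ Heavy (cls (p - k) k) 1 (S j) → ∀ z ∈ S j, ∃ e ∈ F, z ∈ e.set := by
    intro p
    obtain ⟨F, hF, hw, hcov⟩ := h1 p
    obtain ⟨F', hF', hw', hcov'⟩ := (stable_cls (p - k) k).exists_freeBelow_cover
      (heavy_sixteen_univ _ _) hF (by linarith) m
    exact ⟨F', hF', by linarith, fun j hj hl => hcov' (S j) (hfree j) (hcov j hj hl)⟩
  choose F hF hw hcov using h2
  have hne : ∀ p, ∀ e ∈ F p, e.idx.Nonempty := fun p e he =>
    (stable_cls _ _).idx_nonempty e (hF p e he).1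
  let A : ℕ → ℕ → Finset Mark := fun p n => ((F p).filter fun e => e.level ≤ n).image Mark.trunc
  have hAfin : ∀ p n, ∀ e ∈ A p n,
      e ∈ {e' | ∃ e : Mark, e.idx.Nonempty ∧ e.wt < 32 ∧ e.level ≤ n ∧ e' = e.trunc} := by
    intro p n e he
    obtain ⟨e, h, rfl⟩ := Finset.mem_image.mp he
    obtain ⟨he, hl⟩ := Finset.mem_filter.mp h
    refine ⟨e, hne p e he, ?_, hl, rfl⟩
    linarith [hw p, Finset.single_le_sum (f := Mark.wt) (fun f _ => f.wt_nonneg) he]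
  have hHfin : ∀ n, {e | ∀ᶠ p in (Filter.hyperfilter ℕ : Filter ℕ), e ∈ A p n}.Finite :=
    fun n => (finite_trunc n).subset fun e he => by
      obtain ⟨p, hp⟩ := Filter.Eventually.exists he
      exact hAfin p n e hp
  let H : ℕ → Finset Mark := fun n => (hHfin n).toFinset
  have hH : ∀ n e, e ∈ H n ↔ ∀ᶠ p in (Filter.hyperfilter ℕ : Filter ℕ), e ∈ A p n :=
    fun n e => Set.Finite.mem_toFinset _
  -- Only finitely many candidates have level at most `n`, so the ultrafilter decides them all at
  -- once.
  have hAH : ∀ n, ∀ᶠ p in (Filter.hyperfilter ℕ : Filter ℕ), A p n = H n := by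
    intro n
    have : ∀ᶠ p in (Filter.hyperfilter ℕ : Filter ℕ), ∀ e ∈ {e' | ∃ e : Mark, e.idx.Nonempty ∧
        e.wt < 32 ∧ e.level ≤ n ∧ e' = e.trunc}, (e ∈ A p n ↔ e ∈ H n) := by
      rw [Filter.eventually_all_finite (finite_trunc n)]
      intro e _
      by_cases he : e ∈ H n
      · filter_upwards [(hH n e).mp he] with p hp
        simp [hp, he]
      · have he' := he
        rw [hH, ← Ultrafilter.eventually_not] at he'
        filter_upwards [he'] with p hp
        simp [hp, he]
    filter_upwards [this] with p hp
    ext e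
    constructor
    · exact fun he => (hp e (hAfin p n e he)).mp he
    · intro he
      obtain ⟨p', hp'⟩ := ((hH n e).mp he).exists
      exact (hp e (hAfin p' n e hp')).mpr he
  have hA : ∀ p n, ∀ e ∈ A p n, e ∈ cls (p - k) k ∧ FreeBelow m e.set ∧ DependsBelow n e.set := by
    intro p n e he
    obtain ⟨e, h, rfl⟩ := Finset.mem_image.mp he
    obtain ⟨he, hl⟩ := Finset.mem_filter.mp h
    obtain ⟨h1, h2⟩ := hF p e he
    exact ⟨(stable_cls _ _).trunc_mem h1, h2.hull _, (dependsBelow_hull _ _).mono hl⟩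
  refine ⟨H, ?_, ?_, ?_, ?_⟩
  · intro n n' hn e he
    rw [hH] at he ⊢
    filter_upwards [he] with p hp
    exact Finset.image_subset_image
      (Finset.monotone_filter_right _ fun e _ h => le_trans h hn) hp
  · intro n e he
    rw [hH] at he
    obtain ⟨p, hp⟩ := he.exists
    refine ⟨?_, (hA p n e hp).2⟩
    filter_upwards [he] with p hp
    exact (hA p n e hp).1
  · intro n
    obtain ⟨p, hp⟩ := (hAH n).exists
    rw [← hp]
    have := (sum_image_wt_le ((F p).filter fun e => e.level ≤ n) Mark.trunc).trans
      (sum_filter_wt_le _ _ fun e he _ => Mark.wt_trunc_le (hne p e he))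
    linarith [hw p]
  · intro j z hz
    obtain ⟨p, hp, hjp, hl⟩ := ((hAH (N j)).and ((eventually_gt_hyperfilter j).and
      (hlight j))).exists
    obtain ⟨e, he, hle, hze⟩ := (stable_cls (p - k) k).cover_trunc (heavy_sixteen_univ _ _)
      (fun e he => (hF p e he).1) (by linarith [hw p]) (hdep j) (hcov p j hjp.le hl) z hz
    refine ⟨e.trunc, ?_, hze⟩
    rw [← hp]
    exact Finset.mem_image_of_mem _ (Finset.mem_filter.mpr ⟨he, hle⟩)

/-! ### Light sets: disjoint sequences and slices -/

/-- The set `S` has a cover by marks from `C` of weight at most `c`. -/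
def Light (C : Set Mark) (c : ℝ) (S : Set Pt) : Prop :=
  ∃ F : Finset Mark, (∀ e ∈ F, e ∈ C) ∧ (∀ z ∈ S, ∃ e ∈ F, z ∈ e.set) ∧ ∑ e ∈ F, e.wt ≤ c

theorem Light.mono {C C' : Set Mark} {c c' : ℝ} {S S' : Set Pt} (h : Light C c S) (hC : C ⊆ C')
    (hc : c ≤ c') (hS : S' ⊆ S) : Light C' c' S' := by
  obtain ⟨F, hF, hcov, hw⟩ := h
  exact ⟨F, fun e he => hC (hF e he), fun z hz => hcov z (hS hz), hw.trans hc⟩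

theorem light_empty (C : Set Mark) : Light C 0 ∅ := ⟨∅, by simp, by simp, by simp⟩

theorem sum_union_wt_le [DecidableEq Mark] (F F' : Finset Mark) :
    ∑ e ∈ F ∪ F', e.wt ≤ ∑ e ∈ F, e.wt + ∑ e ∈ F', e.wt := by
  have h := Finset.sum_union_inter (s₁ := F) (s₂ := F') (f := Mark.wt)
  have h' : 0 ≤ ∑ e ∈ F ∩ F', e.wt := Finset.sum_nonneg fun e _ => e.wt_nonneg
  linarith

theorem Light.union {C : Set Mark} {c c' : ℝ} {S S' : Set Pt} (h : Light C c S)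
    (h' : Light C c' S') : Light C (c + c') (S ∪ S') := by
  classical
  obtain ⟨F, hF, hcov, hw⟩ := h
  obtain ⟨F', hF', hcov', hw'⟩ := h'
  refine ⟨F ∪ F', fun e he => (Finset.mem_union.mp he).elim (hF e) (hF' e), fun z hz => ?_,
    (sum_union_wt_le F F').trans (add_le_add hw hw')⟩
  rcases hz with hz | hz
  · obtain ⟨e, he, hze⟩ := hcov z hz
    exact ⟨e, Finset.mem_union_left _ he, hze⟩
  · obtain ⟨e, he, hze⟩ := hcov' z hz
    exact ⟨e, Finset.mem_union_right _ he, hze⟩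

theorem Light.biUnion {C : Set Mark} {ι : Type*} (s : Finset ι) {c : ι → ℝ} {S : ι → Set Pt}
    (h : ∀ i ∈ s, Light C (c i) (S i)) : Light C (∑ i ∈ s, c i) (⋃ i ∈ s, S i) := by
  classical
  induction s using Finset.induction_on with
  | empty => simpa using light_empty C
  | insert a s ha ih =>
    rw [Finset.sum_insert ha, Finset.set_biUnion_insert]
    exact (h a (Finset.mem_insert_self a s)).union
      (ih fun i hi => h i (Finset.mem_insert_of_mem hi))

theorem light_of_mem {C : Set Mark} {e : Mark} (he : e ∈ C) : Light C e.wt e.set :=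
  ⟨{e}, by simpa using he, fun z hz => ⟨e, by simp, hz⟩, by simp⟩

/-- The complement of a light set is heavy. -/
theorem Heavy.diff {C : Set Mark} {c c' : ℝ} (h : Heavy C c Set.univ) {F : Finset Mark}
    (hF : ∀ e ∈ F, e ∈ C) (hw : c' + ∑ e ∈ F, e.wt ≤ c) :
    Heavy C c' {z | ∀ e ∈ F, z ∉ e.set} := by
  classical
  intro F' hF' hcov
  have := h (F' ∪ F) (fun e he => (Finset.mem_union.mp he).elim (hF' e) (hF e)) fun z _ => by
    by_cases hz : ∀ e ∈ F, z ∉ e.set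
    · obtain ⟨e, he, hze⟩ := hcov z hz
      exact ⟨e, Finset.mem_union_left _ he, hze⟩
    · push Not at hz
      obtain ⟨e, he, hze⟩ := hz
      exact ⟨e, Finset.mem_union_right _ he, hze⟩
  linarith [sum_union_wt_le F' F]

/-- Above a given atom, all but a light part of each late term of a disjoint sequence has a hull
with heavy complement. -/
theorem exists_light_remainder_above {E : ℕ → Set Pt} (hE : Pairwise (Function.onFun Disjoint E))
    {d : ℕ → ℕ} (hd : ∀ i, DependsBelow (d i) (E i)) (k m : ℕ) (a : Pt) {ε : ℝ} (hε : 0 < ε) :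
    ∃ n i₀, ∀ i ≥ i₀, ∃ R, Light (limCls (k + 1)) ε R ∧
      ∀ᶠ p in (Filter.hyperfilter ℕ : Filter ℕ), Heavy (cls (p - (k + 1)) (k + 1)) 1
        {z | splice m a z ∉ hull n (E i \ R)} := by
  classical
  let S : ℕ → Set Pt := fun j => {z | ∃ i ≤ j, splice m a z ∈ E i}
  let N : ℕ → ℕ := fun j => (Finset.range (j + 1)).sup d
  have hN : ∀ {i j}, i ≤ j → d i ≤ N j := fun {i j} h =>
    Finset.le_sup (f := d) (Finset.mem_range.mpr (by omega))
  have hmono : Monotone S := fun j j' h z ⟨i, hi, hz⟩ => ⟨i, hi.trans h, hz⟩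
  have hdep : ∀ j, DependsBelow (N j) (S j) := by
    rintro j x y hxy ⟨i, hi, hx⟩
    exact ⟨i, hi, (hd i).mono (hN hi) _ _ (causal_splice m a _ _ _ hxy) hx⟩
  have hfree : ∀ j, FreeBelow m (S j) := by
    rintro j x z ⟨i, hi, hz⟩
    exact ⟨i, hi, by rwa [splice_splice]⟩
  by_cases hcase : ∀ j, ∀ᶠ p in (Filter.hyperfilter ℕ : Filter ℕ),
      ¬ Heavy (cls (p - (k + 1)) (k + 1)) 1 (S j)
  · obtain ⟨H, hHm, hH, hHw, hHc⟩ := exists_limit_marks (k + 1) m hmono hdep hfree hcase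
    have hbdd : BddAbove (Set.range fun n => ∑ e ∈ H n, e.wt) := ⟨4, by
      rintro _ ⟨n, rfl⟩; exact hHw n⟩
    -- Marks added after `n₀` weigh at most `ε` together; they cover the part of `E i` in the atom
    -- outside `H n₀`.
    obtain ⟨n₀, hn₀⟩ := exists_lt_of_lt_ciSup (sub_lt_self (⨆ n, ∑ e ∈ H n, e.wt) hε)
    refine ⟨max n₀ m, 0, fun i _ => ⟨{z ∈ E i | AgreeBelow m z a ∧ ∀ e ∈ H n₀, z ∉ e.set},
      ⟨H (N i) \ H n₀, ?_, ?_, ?_⟩, ?_⟩⟩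
    · exact fun e he => (hH _ e (Finset.mem_sdiff.mp he).1).1
    · rintro z ⟨hz, hza, hzH⟩
      obtain ⟨e, he, hze⟩ := hHc i z ⟨i, le_rfl, by rwa [splice_eq_self hza]⟩
      exact ⟨e, Finset.mem_sdiff.mpr ⟨he, fun h => hzH e h hze⟩, hze⟩
    · have h1 := Finset.sum_sdiff (f := Mark.wt) (hHm (le_max_right (N i) n₀))
      have h2 := le_ciSup hbdd (max (N i) n₀)
      have h3 : ∑ e ∈ H (N i) \ H n₀, e.wt ≤ ∑ e ∈ H (max (N i) n₀) \ H n₀, e.wt :=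
        Finset.sum_le_sum_of_subset_of_nonneg
          (Finset.sdiff_subset_sdiff (hHm (le_max_left _ _)) subset_rfl) fun e _ _ => e.wt_nonneg
      linarith
    · have hev : ∀ᶠ p in (Filter.hyperfilter ℕ : Filter ℕ),
          ∀ e ∈ H n₀, e ∈ cls (p - (k + 1)) (k + 1) :=
        (Filter.eventually_all_finset (H n₀)).mpr fun e he => (hH n₀ e he).1
      filter_upwards [hev] with p hp
      refine ((heavy_sixteen_univ _ _).diff (c' := 1) hp (by linarith [hHw n₀])).mono_set ?_
      rintro z hz ⟨y, ⟨hyE, hyR⟩, hyz⟩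
      have hya : AgreeBelow m y a := (hyz.mono (le_max_right _ _)).trans (agreeBelow_splice m a z)
      have : ∃ e ∈ H n₀, y ∈ e.set := by
        by_contra! hcon
        exact hyR ⟨hyE, hya, hcon⟩
      obtain ⟨e, he, hye⟩ := this
      obtain ⟨-, hef, hed⟩ := hH n₀ e he
      have h1 := hef z _ (hed _ _ (hyz.mono (le_max_left _ _)) hye)
      rw [splice_splice, splice_eq_self (.refl m z)] at h1
      exact hz e he h1
  · push Not at hcase
    obtain ⟨j, hj⟩ := hcase
    have hj' : ∀ᶠ p in (Filter.hyperfilter ℕ : Filter ℕ),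
        Heavy (cls (p - (k + 1)) (k + 1)) 1 (S j) := by
      simpa using hj
    -- For `i > j` the set `E i` is disjoint from each `E l` with `l ≤ j`. These depend only on
    -- coordinates below `N j`, so the hull of `E i` at that level misses them too.
    refine ⟨N j, j + 1, fun i hi => ⟨∅, (light_empty _).mono subset_rfl hε.le subset_rfl, ?_⟩⟩
    filter_upwards [hj'] with p hp
    refine hp.mono_set ?_
    rintro z ⟨l, hl, hz⟩ ⟨y, ⟨hy, -⟩, hyz⟩
    have hyl : y ∈ E l := (hd l).mono (hN hl) _ _ hyz.symm hz
    exact Set.disjoint_left.mp (hE (show i ≠ l by omega)) hy hyl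

/-- All but a light part of each late term of a disjoint sequence is thin between `m` and some
`n`. -/
theorem exists_light_remainder_thin {E : ℕ → Set Pt} (hE : Pairwise (Function.onFun Disjoint E))
    {d : ℕ → ℕ} (hd : ∀ i, DependsBelow (d i) (E i)) (k m : ℕ) {ε : ℝ} (hε : 0 < ε) :
    ∃ n > m, ∃ i₀, ∀ i ≥ i₀, ∃ R, Light (limCls (k + 1)) ε R ∧
      ∀ᶠ p in (Filter.hyperfilter ℕ : Filter ℕ),
        Thin (cls (p - (k + 1)) (k + 1)) m n (E i \ R) := by
  classical
  let V := ∀ i : Fin m, Fin (i + 1)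
  have hV : (0 : ℝ) < Fintype.card V := by
    have : Nonempty V := ⟨fun _ => 0⟩
    exact_mod_cast Fintype.card_pos
  choose n i₀ h using fun v : V =>
    exists_light_remainder_above hE hd k m (extend v) (div_pos hε hV)
  refine ⟨max (m + 1) (Finset.univ.sup n), lt_max_of_lt_left (Nat.lt_succ_self m),
    Finset.univ.sup i₀, fun i hi => ?_⟩
  choose R hR hR' using fun v : V =>
    h v i ((Finset.le_sup (f := i₀) (Finset.mem_univ v)).trans hi)
  refine ⟨⋃ v ∈ (Finset.univ : Finset V), R v, ?_, ?_⟩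
  · refine (Light.biUnion Finset.univ fun v _ => hR v).mono subset_rfl ?_ subset_rfl
    rw [Finset.sum_const, Finset.card_univ, nsmul_eq_mul, mul_div_cancel₀ _ hV.ne']
  · filter_upwards [Filter.eventually_all.mpr hR'] with p hp a
    refine (hp fun i => a i).mono_set ?_
    intro z hz hz'
    have h1 : splice m (extend fun i : Fin m => a i) z = splice m a z := by
      funext i
      rcases lt_or_ge i m with him | him
      · rw [splice_of_lt him, splice_of_lt him, agreeBelow_extend m a i him]
      · rw [splice_of_le him, splice_of_le him]
    refine hz ?_
    rw [h1]
    refine hull_subset_hull ((Finset.le_sup (f := n) (Finset.mem_univ _)).trans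
      (le_max_right _ _)) ?_ hz'
    refine Set.sdiff_subset_sdiff_right ?_
    exact Set.subset_biUnion_of_mem (u := R) (Finset.mem_univ (fun i : Fin m => a i))

/-- All but a light part of each late term of a disjoint sequence is thin along a set of indices
of given size. -/
theorem exists_light_remainder_thinOn {E : ℕ → Set Pt} (hE : Pairwise (Function.onFun Disjoint E))
    {d : ℕ → ℕ} (hd : ∀ i, DependsBelow (d i) (E i)) (k : ℕ) {ε : ℝ} (hε : 0 < ε) (N : ℕ) :
    ∃ (I : Finset ℕ) (M : ℕ), I.card = N + 1 ∧ M ∈ I ∧ (∀ x ∈ I, x ≤ M) ∧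
      ∃ i₀, ∀ i ≥ i₀, ∃ R, Light (limCls (k + 1)) (N * ε) R ∧
        ∀ᶠ p in (Filter.hyperfilter ℕ : Filter ℕ),
          ThinOn (cls (p - (k + 1)) (k + 1)) I (E i \ R) := by
  classical
  induction N with
  | zero =>
    refine ⟨{0}, 0, by simp, by simp, by simp, 0, fun i _ => ⟨∅, by simpa using light_empty _, ?_⟩⟩
    refine Filter.Eventually.of_forall fun p x hx y hy hxy => ?_
    rw [Finset.mem_singleton] at hx hy
    omega
  | succ N ih =>
    obtain ⟨I, M, hI, hM, hle, i₀, h⟩ := ih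
    -- Only the pair `(M, n)` needs a new remainder: for `x < M`, thinness between `x` and `M`
    -- implies thinness between `x` and `n`.
    obtain ⟨n, hn, i₁, h'⟩ := exists_light_remainder_thin hE hd k M hε
    have hnI : n ∉ I := fun hn' => absurd (hle n hn') (by omega)
    refine ⟨insert n I, n, by rw [Finset.card_insert_of_notMem hnI, hI],
      Finset.mem_insert_self _ _, ?_, max i₀ i₁, fun i hi => ?_⟩
    · intro x hx
      rcases Finset.mem_insert.mp hx with rfl | hx
      · exact le_rfl
      · exact (hle x hx).trans hn.le
    · obtain ⟨R, hR, ht⟩ := h i ((le_max_left _ _).trans hi)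
      obtain ⟨R', hR', ht'⟩ := h' i ((le_max_right _ _).trans hi)
      refine ⟨R ∪ R', (hR.union hR').mono subset_rfl (by push_cast; linarith) subset_rfl, ?_⟩
      filter_upwards [ht, ht'] with p hp hp' x hx y hy hxy
      have hs : E i \ (R ∪ R') ⊆ E i \ R := Set.sdiff_subset_sdiff_right Set.subset_union_left
      have hs' : E i \ (R ∪ R') ⊆ E i \ R' := Set.sdiff_subset_sdiff_right Set.subset_union_right
      rcases Finset.mem_insert.mp hx with hxn | hxI
      · rcases Finset.mem_insert.mp hy with hyn | hyI
        · omega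
        · exact absurd (hle y hyI) (by omega)
      · rcases Finset.mem_insert.mp hy with hyn | hyI
        · rw [hyn]
          rcases (hle x hxI).eq_or_lt with hxM | hxM
          · rw [hxM]; exact hp'.mono le_rfl hs'
          · exact (hp x hxI M hM hxM).mono hn.le hs
        · exact (hp x hxI y hyI hxy).mono le_rfl hs

/-- The terms of a disjoint sequence eventually become light. -/
theorem eventually_light {E : ℕ → Set Pt} (hE : Pairwise (Function.onFun Disjoint E))
    {d : ℕ → ℕ} (hd : ∀ i, DependsBelow (d i) (E i)) (k : ℕ) {ε : ℝ} (hε : 0 < ε) :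
    ∃ i₀, ∀ i ≥ i₀, Light (limCls 0) (((2 : ℝ) ^ k)⁻¹ + ε) (E i) := by
  obtain ⟨N, hN⟩ : ∃ N, maxCard k = N + 1 := ⟨maxCard k - 1, by have := maxCard_pos k; omega⟩
  obtain ⟨I, M, hI, hM, -, i₀, h⟩ := exists_light_remainder_thinOn hE hd k
    (show 0 < ε / (N + 1) by positivity) N
  refine ⟨i₀, fun i hi => ?_⟩
  obtain ⟨R, hR, ht⟩ := h i hi
  have hmem : (⟨E i \ R, I, k⟩ : Mark) ∈ limCls k := mem_limCls (e := ⟨E i \ R, I, k⟩) ⟨M, hM⟩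
    (by rw [hN, ← hI]) ht
  have h1 := light_of_mem (limCls_antitone (Nat.zero_le k) hmem)
  refine (h1.union (hR.mono (limCls_antitone (Nat.zero_le (k + 1))) le_rfl subset_rfl)).mono
    subset_rfl (add_le_add ?_ ?_) ?_
  · rw [Mark.wt, hI, ← hN, weight_maxCard]
  · rw [mul_div_assoc', div_le_iff₀ (by positivity)]
    nlinarith
  · intro z hz
    by_cases hzR : z ∈ R
    · exact Or.inr hzR
    · exact Or.inl ⟨hz, hzR⟩

/-- Resetting coordinate `m` to `t` pulls a cover of the slice back to a cover of the whole space.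
Each mark loses at most two indices, so weights at most double, far below 16. -/
theorem heavy_coordinate_eq (d k m : ℕ) (t : Fin (m + 1)) :
    Heavy (cls d k) 1 {z : Pt | z m = t} := by
  classical
  have hC := stable_cls d k
  intro F hF hcov
  by_contra! hlt
  let Φ : Pt → Pt := fun z => Function.update z m t
  have hΦ : Causal Φ := by
    intro N x y hxy i hi
    by_cases him : i = m
    · subst him; simp [Φ]
    · simp [Φ, him, hxy i hi]
  have hΦo : FixesOutside m (m + 1) Φ := fun z i hi =>
    Function.update_of_ne (by omega) _ _
  have hcard : ∀ e ∈ F, e.idx.card ≤ 2 * (removeGap e.idx m (m + 1)).card ∧ 0 < e.idx.card := by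
    intro e he
    have h0 := Finset.card_pos.mpr (hC.idx_nonempty e (hF e he))
    have hw : e.wt < 32 :=
      (Finset.single_le_sum (fun f _ => f.wt_nonneg) he).trans_lt (hlt.trans (by norm_num))
    have h1 := le_card_of_weight_lt h0 hw
    have h2 := card_le_card_removeGap e.idx m (m + 1)
    have h3 : (e.idx.filter fun i => m ≤ i ∧ i < m + 1).card ≤ 1 :=
      Finset.card_le_one.mpr fun a ha b hb => by
        have := (Finset.mem_filter.mp ha).2
        have := (Finset.mem_filter.mp hb).2
        omega
    have h4 : 2 ^ 20 ≤ 2 ^ (2 * e.rank + 20) := Nat.pow_le_pow_right (by norm_num) (by omega)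
    norm_num at h4
    omega
  have := (heavy_sixteen_univ d k).le_sum F
    (fun e => ⟨Φ ⁻¹' e.set, removeGap e.idx m (m + 1), e.rank⟩)
    (fun e he => hC.preimage_removeGap (hF e he) hΦ hΦo
      (Finset.card_pos.mp (by have := hcard e he; omega)))
    (fun z _ => hcov (Φ z) (by simp [Φ]))
  have h2 : ∑ e ∈ F, (⟨Φ ⁻¹' e.set, removeGap e.idx m (m + 1), e.rank⟩ : Mark).wt ≤
      ∑ e ∈ F, 2 * e.wt :=
    Finset.sum_le_sum fun e he => weight_le_two_mul (hcard e he).2 (hcard e he).1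
  rw [← Finset.mul_sum] at h2
  linarith

/-- Avoiding one value at each of sufficiently many coordinates defines a light set. -/
theorem light_avoiding (k : ℕ) {I : Finset ℕ} (hI : I.card = maxCard k) (t : Pt) :
    Light (limCls 0) ((2 : ℝ) ^ k)⁻¹ {z : Pt | ∀ i ∈ I, z i ≠ t i} := by
  have hmem : (⟨{z : Pt | ∀ i ∈ I, z i ≠ t i}, I, k⟩ : Mark) ∈ limCls k := by
    refine mem_limCls (e := ⟨{z : Pt | ∀ i ∈ I, z i ≠ t i}, I, k⟩)
      (Finset.card_pos.mp (hI ▸ maxCard_pos k)) hI.le (Filter.Eventually.of_forall ?_)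
    intro p m hm n hn hmn a
    refine (heavy_coordinate_eq _ _ m (t m)).mono_set ?_
    rintro z hz ⟨y, hy, hyz⟩
    refine hy m hm ?_
    rw [hyz m hmn, splice_of_le le_rfl]
    exact hz
  have h1 := light_of_mem (limCls_antitone (Nat.zero_le k) hmem)
  rwa [Mark.wt, hI, weight_maxCard] at h1

/-- A single index makes thinness vacuous. This keeps the infimum in `coverWeight` from ranging over
the empty set. -/
theorem light_univ : ∃ c, Light (limCls 0) c Set.univ := by
  have hmem : (⟨Set.univ, {0}, 0⟩ : Mark) ∈ limCls 0 := by
    refine mem_limCls (e := ⟨Set.univ, {0}, 0⟩) (by simp) ?_ (Filter.Eventually.of_forall ?_)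
    · exact maxCard_pos 0
    · intro p x hx y hy hxy
      simp only [Finset.mem_singleton] at hx hy
      omega
  exact ⟨_, light_of_mem hmem⟩

theorem Light.le_of_univ {c : ℝ} (h : Light (limCls 0) c Set.univ) : 16 ≤ c := by
  obtain ⟨F, hF, hcov, hw⟩ := h
  obtain ⟨p, hp⟩ := ((Filter.eventually_all_finset F).mpr hF).exists
  exact (heavy_sixteen_univ _ _ F hp hcov).trans hw

/-! ### Completion of seminormed Boolean rings -/

/-- A Boolean ring with a seminorm that is monotone. -/
class SeminormedBooleanRing (R : Type*) extends BooleanRing R, SeminormedAddCommGroup R where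
  norm_mul_le' : ∀ a b : R, ‖a * b‖ ≤ ‖a‖

section SeminormedBooleanRing

variable {R : Type*} [SeminormedBooleanRing R]

theorem norm_mul_le_fst (a b : R) : ‖a * b‖ ≤ ‖a‖ := SeminormedBooleanRing.norm_mul_le' a b

theorem norm_mul_le_snd (a b : R) : ‖a * b‖ ≤ ‖b‖ := by
  rw [mul_comm]; exact norm_mul_le_fst b a

instance : IsTopologicalRing R where
  continuous_mul := by
    refine continuous_iff_continuousAt.mpr fun ⟨a, b⟩ => ?_
    rw [ContinuousAt, tendsto_iff_norm_sub_tendsto_zero]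
    have h1 : Filter.Tendsto (fun x : R × R => ‖x.1 - a‖ + ‖x.2 - b‖) (nhds (a, b)) (nhds 0) := by
      have : Continuous fun x : R × R => ‖x.1 - a‖ + ‖x.2 - b‖ := by fun_prop
      simpa using this.tendsto (a, b)
    refine squeeze_zero (fun _ => norm_nonneg _) (fun x => ?_) h1
    have : x.1 * x.2 - a * b = (x.1 - a) * x.2 + a * (x.2 - b) := by ring
    rw [this]
    exact (norm_add_le _ _).trans (add_le_add (norm_mul_le_fst _ _) (norm_mul_le_snd _ _))

/-- The norm tends to zero along sequences of disjoint elements. -/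
def Exhaustive (R : Type*) [SeminormedBooleanRing R] : Prop :=
  ∀ E : ℕ → R, (∀ i j, i < j → E i * E j = 0) →
    Filter.Tendsto (fun i => ‖E i‖) Filter.atTop (nhds 0)

open UniformSpace in
noncomputable instance : SeminormedBooleanRing (Completion R) :=
  { (inferInstance : Ring (Completion R)),
    (inferInstance : NormedAddCommGroup (Completion R)) with
    isIdempotentElem := fun a => by
      induction a using Completion.induction_on with
      | hp => exact isClosed_eq (continuous_id.mul continuous_id) continuous_id
      | ih a => rw [IsIdempotentElem, ← Completion.coe_mul, BooleanRing.mul_self]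
    norm_mul_le' := fun a b => by
      induction a, b using Completion.induction_on₂ with
      | hp =>
        exact isClosed_le (continuous_norm.comp (continuous_fst.mul continuous_snd))
          (continuous_norm.comp continuous_fst)
      | ih a b =>
        rw [← Completion.coe_mul, Completion.norm_coe, Completion.norm_coe]
        exact norm_mul_le_fst a b }

/-- The part of `e n` that is disjoint from `e i` for `i < n`. -/
def disjointify (e : ℕ → R) (x : R) (n : ℕ) : R := x * ∏ j ∈ Finset.range n, (1 - e j)

theorem norm_mul_prod_sub_le (d e : ℕ → R) (x y : R) (n : ℕ) :
    ‖disjointify d x n - disjointify e y n‖ ≤ ‖x - y‖ + ∑ j ∈ Finset.range n, ‖d j - e j‖ := by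
  unfold disjointify
  induction n with
  | zero => simp
  | succ n ih =>
    rw [Finset.prod_range_succ, Finset.prod_range_succ, Finset.sum_range_succ]
    set P := ∏ j ∈ Finset.range n, (1 - d j)
    set Q := ∏ j ∈ Finset.range n, (1 - e j)
    have h : x * (P * (1 - d n)) - y * (Q * (1 - e n)) =
        (x * P - y * Q) * (1 - d n) - y * Q * (d n - e n) := by ring
    rw [h]
    refine (norm_sub_le _ _).trans ?_
    have h1 := norm_mul_le_fst (x * P - y * Q) (1 - d n)
    have h2 := norm_mul_le_snd (y * Q) (d n - e n)
    linarith

theorem disjointify_of_disjoint {d : ℕ → R} {x : R} {n : ℕ} (h : ∀ j < n, d j * x = 0) :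
    disjointify d x n = x := by
  unfold disjointify
  induction n with
  | zero => simp
  | succ n ih =>
    rw [Finset.prod_range_succ, ← mul_assoc, ih fun j hj => h j (hj.trans n.lt_succ_self), mul_sub,
      mul_comm x, mul_comm x, one_mul, h n n.lt_succ_self, sub_zero]

theorem disjointify_mul (e : ℕ → R) {i j : ℕ} (hij : i < j) :
    disjointify e (e i) i * disjointify e (e j) j = 0 := by
  unfold disjointify
  obtain ⟨P, hP⟩ := Finset.dvd_prod_of_mem (fun j => 1 - e j) (Finset.mem_range.mpr hij)
  rw [hP]
  have h : e i * (1 - e i) = 0 := by rw [mul_sub, mul_one, BooleanRing.mul_self, sub_self]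
  calc _ = e i * (1 - e i) * ((∏ j ∈ Finset.range i, (1 - e j)) * e j * P) := by ring
    _ = 0 := by rw [h, zero_mul]

theorem sum_geometric_le {ε : ℝ} (hε : 0 < ε) (n : ℕ) :
    ∑ j ∈ Finset.range n, ε / 2 / 2 ^ j ≤ ε := by
  have h : ∑ j ∈ Finset.range n, ε / 2 / 2 ^ j = ε - ε / 2 ^ n := by
    induction n with
    | zero => simp
    | succ n ih => rw [Finset.sum_range_succ, ih, pow_succ]; field_simp; ring
  rw [h]
  have : 0 < ε / 2 ^ n := by positivity
  linarith

open UniformSpace in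
-- Approximate the terms from `R` with geometrically small errors and make the approximants
-- disjoint. As `d n` is already disjoint from the earlier terms, `disjointify` fixes it, so the
-- disjoint approximants stay close to `d n`.
theorem Exhaustive.completion (h : Exhaustive R) : Exhaustive (Completion R) := by
  intro d hd
  rw [Metric.tendsto_atTop]
  intro ε hε
  have hε4 : 0 < ε / 4 := by positivity
  have happ : ∀ j : ℕ, ∃ e : R, ‖d j - (e : Completion R)‖ ≤ ε / 4 / 2 / 2 ^ j := by
    intro j
    obtain ⟨e, he⟩ := Completion.denseRange_coe.exists_dist_lt (d j)
      (show 0 < ε / 4 / 2 / 2 ^ j by positivity)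
    exact ⟨e, by rw [← dist_eq_norm]; exact he.le⟩
  choose e he using happ
  have hcoe : ∀ n (x : R), ((disjointify e x n : R) : Completion R) =
      disjointify (fun j => (e j : Completion R)) (x : Completion R) n := by
    intro n x
    unfold disjointify
    induction n with
    | zero => simp
    | succ n ih =>
      rw [Finset.prod_range_succ, Finset.prod_range_succ, ← mul_assoc, Completion.coe_mul, ih,
        Completion.coe_sub, Completion.coe_one, mul_assoc]
  obtain ⟨N, hN⟩ := (Metric.tendsto_atTop.mp (h (fun i => disjointify e (e i) i)
    fun i j hij => disjointify_mul e hij)) (ε / 4) hε4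
  refine ⟨N, fun n hn => ?_⟩
  have h1 := hN n hn
  rw [Real.dist_0_eq_abs, abs_norm] at h1 ⊢
  have h2 := norm_mul_prod_sub_le d (fun j => (e j : Completion R)) (d n) (e n : Completion R) n
  rw [disjointify_of_disjoint fun j hj => hd j n hj, ← hcoe] at h2
  have h3 : ∑ j ∈ Finset.range n, ‖d j - (e j : Completion R)‖ ≤ ε / 4 :=
    (Finset.sum_le_sum fun j _ => he j).trans (sum_geometric_le hε4 n)
  have h4 : ‖d n - (e n : Completion R)‖ ≤ ε / 4 :=
    (he n).trans (by
      have : (1 : ℝ) ≤ 2 ^ n := one_le_pow₀ (by norm_num)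
      rw [div_div, div_le_iff₀ (by positivity)]
      nlinarith)
  have h5 : ‖d n‖ ≤ ‖d n - ((disjointify e (e n) n : R) : Completion R)‖ +
      ‖((disjointify e (e n) n : R) : Completion R)‖ := by
    simpa using norm_add_le (d n - ((disjointify e (e n) n : R) : Completion R))
      ((disjointify e (e n) n : R) : Completion R)
  rw [Completion.norm_coe] at h5
  linarith

/-- Otherwise a subsequence has successive differences bounded below in norm, yet differences of an
increasing sequence are disjoint. -/
theorem Exhaustive.cauchySeq (h : Exhaustive R) {b : ℕ → R}
    (hb : ∀ i j, i ≤ j → b i * b j = b i) : CauchySeq b := by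
  rw [Metric.cauchySeq_iff']
  by_contra! hcon
  obtain ⟨ε, hε, hcon⟩ := hcon
  choose g hg hg' using hcon
  let s : ℕ → ℕ := fun i => g^[i] 0
  have hs : ∀ i, s (i + 1) = g (s i) := fun i => Function.iterate_succ_apply' g i 0
  have hsm : Monotone s := monotone_nat_of_le_succ fun i => by rw [hs]; exact hg _
  have hlim := h (fun i => b (s (i + 1)) - b (s i)) fun i j hij => by
    have h1 : b (s (i + 1)) * b (s (j + 1)) = b (s (i + 1)) := hb _ _ (hsm (by omega))
    have h2 : b (s (i + 1)) * b (s j) = b (s (i + 1)) := hb _ _ (hsm (by omega))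
    have h3 : b (s i) * b (s (j + 1)) = b (s i) := hb _ _ (hsm (by omega))
    have h4 : b (s i) * b (s j) = b (s i) := hb _ _ (hsm (by omega))
    rw [sub_mul, mul_sub, mul_sub, h1, h2, h3, h4]
    simp
  have hge : ∀ i, ε ≤ ‖b (s (i + 1)) - b (s i)‖ := fun i => by
    rw [hs, ← dist_eq_norm]
    exact hg' (s i)
  exact absurd (ge_of_tendsto' hlim hge) (not_le.mpr hε)

/-- The value of the norm on the associated Boolean algebra. -/
noncomputable def normAlg (a : AsBoolAlg R) : ℝ≥0 := ‖ofBoolAlg a‖₊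

theorem isSubmeasure_normAlg : IsSubmeasure (normAlg (R := R)) where
  map_bot := by simp [normAlg]
  mono a b hab := by
    rw [← ofBoolAlg_mul_ofBoolAlg_eq_left_iff] at hab
    change ‖ofBoolAlg a‖ ≤ ‖ofBoolAlg b‖
    rw [← hab]
    exact norm_mul_le_snd _ _
  map_sup_le a b := by
    change ‖ofBoolAlg (a ⊔ b)‖ ≤ ‖ofBoolAlg a‖ + ‖ofBoolAlg b‖
    have : ofBoolAlg (a ⊔ b) = ofBoolAlg a + ofBoolAlg b * (1 + ofBoolAlg a) := by
      rw [ofBoolAlg_sup]; ring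
    rw [this]
    exact (norm_add_le _ _).trans (add_le_add_right (norm_mul_le_fst _ _) _)

/-- The metric limit is the supremum: the order is the equation `x * y = x`, which passes to limits.
-/
theorem tendsto_of_monotone [CompleteSpace R] [T2Space R] (h : Exhaustive R)
    {b : ℕ → AsBoolAlg R} (hb : Monotone b) :
    ∃ L, IsLUB (Set.range b) L ∧
      Filter.Tendsto (fun n => ofBoolAlg (b n)) Filter.atTop (nhds (ofBoolAlg L)) := by
  have hle : ∀ i j, i ≤ j → ofBoolAlg (b i) * ofBoolAlg (b j) = ofBoolAlg (b i) :=
    fun i j hij => ofBoolAlg_mul_ofBoolAlg_eq_left_iff.mpr (hb hij)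
  obtain ⟨L, hL⟩ := cauchySeq_tendsto_of_complete (h.cauchySeq hle)
  refine ⟨toBoolAlg L, ⟨?_, ?_⟩, hL⟩
  · rintro _ ⟨n, rfl⟩
    rw [← ofBoolAlg_mul_ofBoolAlg_eq_left_iff]
    exact tendsto_nhds_unique (hL.const_mul (ofBoolAlg (b n)))
      (tendsto_const_nhds.congr' (Filter.eventually_atTop.mpr ⟨n, fun m hm => (hle n m hm).symm⟩))
  · intro c hc
    rw [← ofBoolAlg_mul_ofBoolAlg_eq_left_iff]
    refine tendsto_nhds_unique ((hL.mul_const (ofBoolAlg c)).congr fun n => ?_) hL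
    exact ofBoolAlg_mul_ofBoolAlg_eq_left_iff.mpr (hc ⟨n, rfl⟩)

theorem isSigmaComplete_asBoolAlg [CompleteSpace R] [T2Space R] (h : Exhaustive R) :
    IsSigmaComplete (AsBoolAlg R) := by
  intro s hs
  rcases s.eq_empty_or_nonempty with rfl | hne
  · exact ⟨⊥, isLUB_empty⟩
  · obtain ⟨f, rfl⟩ := hs.exists_eq_range hne
    obtain ⟨L, hL, -⟩ := tendsto_of_monotone h (partialSups f).monotone
    refine ⟨L, ?_⟩
    have : upperBounds (Set.range (partialSups f)) = upperBounds (Set.range f) :=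
      upperBounds_range_partialSups f
    rwa [IsLUB, this] at hL

theorem isContinuous_normAlg [CompleteSpace R] [T2Space R] (h : Exhaustive R) :
    IsContinuous (normAlg (R := R)) := by
  intro A hA hglb
  obtain ⟨L, hL, hlim⟩ := tendsto_of_monotone h (b := fun n => (A n)ᶜ)
    fun i j hij => compl_le_compl (hA hij)
  have hLtop : L = ⊤ := by
    rw [← compl_eq_bot, ← le_bot_iff]
    refine hglb.2 ?_
    rintro _ ⟨n, rfl⟩
    exact compl_le_of_compl_le (hL.1 ⟨n, rfl⟩)
  rw [hLtop, ofBoolAlg_top] at hlim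
  have h1 : Filter.Tendsto (fun n => ‖1 - ofBoolAlg (A n)ᶜ‖₊) Filter.atTop (nhds ‖(1 : R) - 1‖₊) :=
    (hlim.const_sub 1).nnnorm
  rw [sub_self, nnnorm_zero] at h1
  refine h1.congr fun n => ?_
  rw [normAlg, ofBoolAlg_compl, sub_add_cancel_left, nnnorm_neg]

end SeminormedBooleanRing

/-- A Boolean algebra with an exhaustive submeasure embeds isometrically into a submeasure
algebra. -/
theorem exists_submeasureAlgebra {α : Type} [BooleanAlgebra α] {ν : α → ℝ} (h0 : ν ⊥ = 0)
    (hmono : ∀ a b, a ≤ b → ν a ≤ ν b) (hsup : ∀ a b, ν (a ⊔ b) ≤ ν a + ν b)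
    (hex : ∀ E : ℕ → α, Pairwise (Function.onFun Disjoint E) →
      Filter.Tendsto (fun i => ν (E i)) Filter.atTop (nhds 0)) :
    ∃ (B : Type) (_ : BooleanAlgebra B) (νB : B → ℝ≥0) (j : BoundedLatticeHom α B),
      IsSigmaComplete B ∧ IsSubmeasure νB ∧ IsPositive νB ∧ IsContinuous νB ∧
      ∀ a, (νB (j a) : ℝ) = ν a := by
  let N : AddGroupSeminorm (AsBoolRing α) :=
    { toFun := fun a => ν (ofBoolRing a)
      map_zero' := h0
      add_le' := fun a b => (hmono _ _ (symmDiff_le_sup)).trans (hsup _ _)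
      neg' := fun a => rfl }
  let _ : SeminormedBooleanRing (AsBoolRing α) :=
    { (inferInstance : BooleanRing (AsBoolRing α)), N.toSeminormedAddCommGroup with
      norm_mul_le' := fun a b => hmono _ _ inf_le_left }
  have hnorm : ∀ a : AsBoolRing α, ‖a‖ = ν (ofBoolRing a) := fun a => rfl
  have hR : Exhaustive (AsBoolRing α) := by
    intro E hE
    refine hex (fun i => ofBoolRing (E i)) ?_
    have key : ∀ i j, i < j → Disjoint (ofBoolRing (E i)) (ofBoolRing (E j)) := fun i j hij =>
      disjoint_iff.mpr (hE i j hij)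
    intro i j hij
    rcases lt_or_gt_of_ne hij with h | h
    · exact key i j h
    · exact (key j i h).symm
  let J : AsBoolRing α → UniformSpace.Completion (AsBoolRing α) := fun a => a
  have hJadd : ∀ a b, J (a + b) = J a + J b := UniformSpace.Completion.coe_add
  have hJmul : ∀ a b, J (a * b) = J a * J b := UniformSpace.Completion.coe_mul
  refine ⟨AsBoolAlg (UniformSpace.Completion (AsBoolRing α)), inferInstance, normAlg,
    { toFun := fun a => toBoolAlg (J (toBoolRing a))
      map_sup' := fun a b => ?_
      map_inf' := fun a b => ?_
      map_top' := ?_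
      map_bot' := ?_ }, isSigmaComplete_asBoolAlg hR.completion, isSubmeasure_normAlg, ?_,
    isContinuous_normAlg hR.completion, fun a => ?_⟩
  · have h1 : toBoolRing (a ⊔ b) = toBoolRing a + toBoolRing b + toBoolRing a * toBoolRing b := by
      change a ⊔ b = symmDiff (symmDiff a b) (a ⊓ b)
      simp
    rw [h1, hJadd, hJadd, hJmul]
    rfl
  · exact congrArg toBoolAlg (hJmul (toBoolRing a) (toBoolRing b))
  · exact congrArg toBoolAlg (UniformSpace.Completion.coe_one (AsBoolRing α))
  · exact congrArg toBoolAlg UniformSpace.Completion.coe_zero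
  · intro a ha
    exact (norm_eq_zero (a := (ofBoolAlg a : UniformSpace.Completion (AsBoolRing α)))).mp
      (congrArg NNReal.toReal ha)
  · exact (UniformSpace.Completion.norm_coe (toBoolRing a)).trans (hnorm _)

/-! ### The covering weight on cylinders -/

/-- The Boolean algebra of the sets depending on finitely many coordinates. -/
def cylinders : BooleanSubalgebra (Set Pt) where
  carrier := {S | ∃ n, DependsBelow n S}
  supClosed' := by
    rintro S ⟨n, hn⟩ S' ⟨n', hn'⟩
    exact ⟨max n n', fun x y hxy => Or.imp (hn.mono (le_max_left _ _) x y hxy)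
      (hn'.mono (le_max_right _ _) x y hxy)⟩
  infClosed' := by
    rintro S ⟨n, hn⟩ S' ⟨n', hn'⟩
    exact ⟨max n n', fun x y hxy => And.imp (hn.mono (le_max_left _ _) x y hxy)
      (hn'.mono (le_max_right _ _) x y hxy)⟩
  compl_mem' := by
    rintro S ⟨n, hn⟩
    exact ⟨n, fun x y hxy hx hy => hx (hn y x hxy.symm hy)⟩
  bot_mem' := ⟨0, fun _ _ _ h => h⟩

/-- The least weight of a cover of a set by marks from `limCls 0`. -/
noncomputable def coverWeight (S : Set Pt) : ℝ := sInf {c | Light (limCls 0) c S}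

theorem Light.nonneg {C : Set Mark} {c : ℝ} {S : Set Pt} (h : Light C c S) : 0 ≤ c := by
  obtain ⟨F, -, -, hw⟩ := h
  exact (Finset.sum_nonneg fun e _ => e.wt_nonneg).trans hw

theorem coverWeight_le {c : ℝ} {S : Set Pt} (h : Light (limCls 0) c S) : coverWeight S ≤ c :=
  csInf_le ⟨0, fun _ h => h.nonneg⟩ h

theorem le_coverWeight {c : ℝ} {S : Set Pt} (h : ∀ c', Light (limCls 0) c' S → c ≤ c') :
    c ≤ coverWeight S := by
  obtain ⟨c', hc'⟩ := light_univ
  exact le_csInf ⟨c', hc'.mono subset_rfl le_rfl (Set.subset_univ S)⟩ h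

theorem coverWeight_nonneg (S : Set Pt) : 0 ≤ coverWeight S := le_coverWeight fun _ h => h.nonneg

theorem coverWeight_mono {S S' : Set Pt} (h : S ⊆ S') : coverWeight S ≤ coverWeight S' :=
  le_coverWeight fun _ hc => coverWeight_le (hc.mono subset_rfl le_rfl h)

theorem coverWeight_union_le (S S' : Set Pt) :
    coverWeight (S ∪ S') ≤ coverWeight S + coverWeight S' := by
  rw [← sub_le_iff_le_add]
  refine le_coverWeight fun c hc => ?_
  rw [sub_le_comm]
  refine le_coverWeight fun c' hc' => ?_
  rw [sub_le_iff_le_add, add_comm]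
  exact coverWeight_le (hc.union hc')

theorem tendsto_coverWeight {E : ℕ → cylinders} (hE : Pairwise (Function.onFun Disjoint E)) :
    Filter.Tendsto (fun i => coverWeight (E i : Set Pt)) Filter.atTop (nhds 0) := by
  choose d hd using fun i => (E i).2
  have hE' : Pairwise (Function.onFun Disjoint fun i => (E i : Set Pt)) := fun i j hij => by
    have := disjoint_iff.mp (hE hij)
    rw [Function.onFun, disjoint_iff]
    exact congrArg Subtype.val this
  rw [Metric.tendsto_atTop]
  intro ε hε
  obtain ⟨k, hk⟩ := exists_pow_lt_of_lt_one (half_pos hε) (show (1 / 2 : ℝ) < 1 by norm_num)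
  obtain ⟨i₀, hi⟩ := eventually_light hE' hd k (half_pos hε)
  refine ⟨i₀, fun i hi' => ?_⟩
  rw [Real.dist_0_eq_abs, abs_of_nonneg (coverWeight_nonneg _)]
  rw [one_div, inv_pow] at hk
  linarith [coverWeight_le (hi i hi')]

/-- The set of points with a given coordinate. -/
def slice (i : ℕ) (t : Fin (i + 1)) : cylinders :=
  ⟨{z | z i = t}, i + 1, fun _ _ hxy hx => (hxy i (Nat.lt_succ_self i)).symm.trans hx⟩

/-! ### Measures and their concentration on light sets -/

section Measure

variable {B : Type*} [BooleanAlgebra B]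

theorem IsMeasure.sup_le_sum {μ : B → ℝ≥0} (hμ : IsMeasure μ) {ι : Type*} (s : Finset ι)
    (a : ι → B) : μ (s.sup a) ≤ ∑ i ∈ s, μ (a i) := by
  classical
  induction s using Finset.induction_on with
  | empty => simp [hμ.map_bot]
  | insert i s hi ih =>
    rw [Finset.sup_insert, Finset.sum_insert hi]
    exact (hμ.map_sup_le _ _).trans (add_le_add_right ih _)

theorem IsMeasure.sup_eq_sum {μ : B → ℝ≥0} (hμ : IsMeasure μ) {ι : Type*} (s : Finset ι)
    {a : ι → B} (ha : ∀ i ∈ s, ∀ j ∈ s, i ≠ j → Disjoint (a i) (a j)) :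
    μ (s.sup a) = ∑ i ∈ s, μ (a i) := by
  classical
  induction s using Finset.induction_on with
  | empty => simp [hμ.map_bot]
  | insert i s hi ih =>
    rw [Finset.sup_insert, Finset.sum_insert hi, hμ.map_sup_of_disjoint, ih]
    · exact fun j hj l hl => ha j (Finset.mem_insert_of_mem hj) l (Finset.mem_insert_of_mem hl)
    · refine Finset.disjoint_sup_right.mpr fun j hj => ?_
      exact ha i (Finset.mem_insert_self _ _) j (Finset.mem_insert_of_mem hj)
        fun h => hi (h ▸ hj)

theorem IsMeasure.comap {A : Type*} [BooleanAlgebra A] {μ : B → ℝ≥0} (hμ : IsMeasure μ)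
    (j : BoundedLatticeHom A B) : IsMeasure fun a => μ (j a) where
  map_bot := by rw [map_bot, hμ.map_bot]
  mono a b hab := hμ.mono _ _ (OrderHomClass.mono j hab)
  map_sup_le a b := by rw [map_sup]; exact hμ.map_sup_le _ _
  map_sup_of_disjoint a b hab := by
    rw [map_sup]
    exact hμ.map_sup_of_disjoint _ _ (hab.map j)

/-- A bound for a continuous submeasure on finite suprema extends to countable suprema. -/
theorem IsSubmeasure.le_of_isLUB {ν : B → ℝ≥0} (hν : IsSubmeasure ν) (hc : IsContinuous ν)
    {x : ℕ → B} {y : B} (hy : IsLUB (Set.range x) y) {c : ℝ≥0}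
    (h : ∀ n, ν (partialSups x n) ≤ c) : ν y ≤ c := by
  have hA : Antitone fun n => y \ partialSups x n := fun m n hmn =>
    sdiff_le_sdiff_left ((partialSups x).monotone hmn)
  have hglb : IsGLB (Set.range fun n => y \ partialSups x n) ⊥ := by
    refine ⟨fun _ _ => bot_le, fun l hl => ?_⟩
    have h1 : ∀ n, l ≤ y \ partialSups x n := fun n => hl ⟨n, rfl⟩
    have h2 : y ≤ lᶜ := by
      refine hy.2 ?_
      rintro _ ⟨n, rfl⟩
      refine (le_partialSups x n).trans (le_compl_comm.mp ((h1 n).trans ?_))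
      rw [sdiff_eq]
      exact inf_le_right
    have h3 : l ≤ lᶜ := ((h1 0).trans sdiff_le).trans h2
    exact (le_compl_self.mp h3).le
  have hlim := (hc _ hA hglb).const_add c
  rw [add_zero] at hlim
  refine ge_of_tendsto' hlim fun n => ?_
  calc ν y ≤ ν (partialSups x n ⊔ y \ partialSups x n) :=
        hν.mono _ _ (by rw [sup_sdiff_self_right]; exact le_sup_right)
    _ ≤ ν (partialSups x n) + ν (y \ partialSups x n) := hν.map_sup_le _ _
    _ ≤ c + ν (y \ partialSups x n) := by gcongr; exact h n

end Measure

/-- Every measure on the cylinders is concentrated on sets of small covering weight. -/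
theorem exists_coverWeight_le {μ : cylinders → ℝ≥0} (hμ : IsMeasure μ) (k : ℕ) :
    ∃ X : cylinders, coverWeight (X : Set Pt) ≤ ((2 : ℝ) ^ k)⁻¹ ∧ μ Xᶜ ≤ (2 ^ k)⁻¹ := by
  classical
  -- Pigeonhole over `i + 1` disjoint slices; the growing coordinate ranges make this bound tend to
  -- zero.
  have hslice : ∀ i, ∃ t, ((i + 1 : ℕ) : ℝ≥0) * μ (slice i t) ≤ μ ⊤ := by
    intro i
    obtain ⟨t, -, ht⟩ := Finset.exists_min_image Finset.univ (fun t => μ (slice i t))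
      ⟨0, Finset.mem_univ _⟩
    refine ⟨t, ?_⟩
    have h1 := hμ.sup_eq_sum Finset.univ (a := slice i) fun s _ t _ hst => by
      rw [disjoint_iff]
      refine Subtype.ext (Set.eq_empty_of_forall_notMem fun z hz => hst ?_)
      exact hz.1.symm.trans hz.2
    calc ((i + 1 : ℕ) : ℝ≥0) * μ (slice i t) = ∑ _s : Fin (i + 1), μ (slice i t) := by simp
      _ ≤ ∑ s, μ (slice i s) := Finset.sum_le_sum fun s hs => ht s hs
      _ = μ (Finset.univ.sup (slice i)) := h1.symm
      _ ≤ μ ⊤ := hμ.mono _ _ le_top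
  choose t ht using hslice
  -- From `M` on, `maxCard k` slices of mass at most `μ ⊤ / (M + 1)` add up to at most `2^(-k)`.
  obtain ⟨M, hM⟩ := exists_nat_ge ((maxCard k : ℝ≥0) * μ ⊤ * 2 ^ k)
  let I := Finset.Ico M (M + maxCard k)
  have hI : I.card = maxCard k := by simp [I]
  let Y : cylinders := I.sup fun i => slice i (t i)
  have hmem : ∀ (s : Finset ℕ) (z : Pt),
      z ∈ ((s.sup fun i => slice i (t i) : cylinders) : Set Pt) ↔ ∃ i ∈ s, z i = t i := by
    intro s z
    induction s using Finset.induction_on with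
    | empty => simp
    | insert i s hi ih =>
      rw [Finset.sup_insert, Finset.exists_mem_insert, ← ih]
      rfl
  refine ⟨Yᶜ, coverWeight_le ((light_avoiding k hI t).mono subset_rfl le_rfl fun z hz i hi hzi =>
    hz ((hmem I z).mpr ⟨i, hi, hzi⟩)), ?_⟩
  rw [compl_compl]
  refine (hμ.sup_le_sum I _).trans ?_
  have hterm : ∀ i ∈ I, μ (slice i (t i)) ≤ μ ⊤ / (M + 1) := by
    intro i hi
    have hMi := (Finset.mem_Ico.mp hi).1
    rw [le_div_iff₀ (by positivity), mul_comm]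
    refine le_trans ?_ (ht i)
    gcongr
    push_cast
    have : (M : ℝ≥0) ≤ i := by exact_mod_cast hMi
    gcongr
  refine (Finset.sum_le_sum hterm).trans ?_
  rw [Finset.sum_const, hI, nsmul_eq_mul, mul_div_assoc', div_le_iff₀ (by positivity)]
  rw [← div_eq_inv_mul, le_div_iff₀ (by positivity)]
  exact hM.trans (le_add_of_nonneg_right zero_le_one)

/-- The terms with index at least `K` of a sequence with geometrically decreasing values have a
supremum of small value. -/
theorem IsSubmeasure.partialSups_shift_le {B : Type*} [BooleanAlgebra B] {ν : B → ℝ≥0}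
    (hν : IsSubmeasure ν) {x : ℕ → B} (hx : ∀ k, ν (x k) ≤ (2 ^ k)⁻¹) (K n : ℕ) :
    ν (partialSups (fun k => x (K + k)) n) ≤ 2 * (2 ^ K)⁻¹ := by
  -- The added term is the unused tail of the geometric series, which lets the induction close.
  have h : ν (partialSups (fun k => x (K + k)) n) + (2 ^ (K + n))⁻¹ ≤ 2 * (2 ^ K)⁻¹ := by
    induction n with
    | zero =>
      rw [partialSups_zero, add_zero, two_mul]
      gcongr
      exact hx K
    | succ n ih =>
      rw [partialSups_add_one]
      refine le_trans ?_ ih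
      have h2 : (2 ^ (K + n) : ℝ≥0)⁻¹ = (2 ^ (K + (n + 1)))⁻¹ + (2 ^ (K + (n + 1)))⁻¹ := by
        rw [← add_assoc, pow_succ, mul_inv, ← mul_add, ← two_mul, mul_inv_cancel₀ two_ne_zero,
          mul_one]
      rw [h2, ← add_assoc (ν _)]
      exact add_le_add_left ((hν.map_sup_le _ _).trans (add_le_add_right (hx _) _)) _
  exact le_self_add.trans h

end Maharam

/-! ### Conclusion -/

theorem theorem1p2 :
    ∃ (B : Type) (_ : BooleanAlgebra B),
      Maharam.IsSubmeasureAlgebra B ∧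
      ¬ Maharam.IsMeasureAlgebra B ∧
      (¬ ∃ μ : B → ℝ≥0, Maharam.IsMeasure μ ∧ Maharam.IsPositive μ) ∧
      (¬ ∃ μ : B → ℝ≥0, Maharam.IsMeasure μ ∧ Maharam.IsContinuous μ ∧ μ ≠ 0) := by
  obtain ⟨B, iB, ν, j, hσ, hν, hpos, hcont, hj⟩ := Maharam.exists_submeasureAlgebra
    (α := Maharam.cylinders) (ν := fun S => Maharam.coverWeight (S : Set Maharam.Pt))
    (le_antisymm (Maharam.coverWeight_le (Maharam.light_empty _)) (Maharam.coverWeight_nonneg _))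
    (fun _ _ h => Maharam.coverWeight_mono h) (fun _ _ => Maharam.coverWeight_union_le _ _)
    (fun _ hE => Maharam.tendsto_coverWeight hE)
  -- `Y K` is the supremum of the images of the `X k` with `k ≥ K`: `ν` is controlled by a geometric
  -- series, while the complement of `Y K` lies below the complement of each of them.
  have hsmall : ∀ μ : B → ℝ≥0, Maharam.IsMeasure μ → ∃ Y : ℕ → B, Antitone Y ∧
      (∀ K, ν (Y K) ≤ 2 * (2 ^ K)⁻¹) ∧ ∀ K, μ (Y K)ᶜ = 0 := by
    intro μ hμ
    choose X hX hXμ using fun k => Maharam.exists_coverWeight_le (hμ.comap j) k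
    have hXν : ∀ k, ν (j (X k)) ≤ (2 ^ k)⁻¹ := fun k => by
      rw [← NNReal.coe_le_coe, hj]
      exact_mod_cast hX k
    choose Y hY using fun K => hσ (Set.range fun k => j (X (K + k))) (Set.countable_range _)
    refine ⟨Y, antitone_nat_of_succ_le fun K => ?_, fun K => ?_, fun K => ?_⟩
    · refine (hY (K + 1)).2 ?_
      rintro _ ⟨k, rfl⟩
      exact (hY K).1 ⟨k + 1, congrArg (fun l => j (X l)) (by ring)⟩
    · exact hν.le_of_isLUB hcont (hY K) (hν.partialSups_shift_le hXν K)
    · refine le_antisymm (le_of_forall_pos_le_add fun ε hε => ?_) zero_le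
      obtain ⟨k, hk⟩ := exists_pow_lt_of_lt_one hε (show (1 / 2 : ℝ≥0) < 1 by
        rw [← NNReal.coe_lt_coe]; norm_num)
      rw [zero_add]
      refine le_trans ?_ hk.le
      calc μ (Y K)ᶜ ≤ μ (j (X (K + k))ᶜ) := by
            refine hμ.mono _ _ ?_
            rw [map_compl']
            exact compl_le_compl ((hY K).1 ⟨k, rfl⟩)
        _ ≤ (2 ^ (K + k))⁻¹ := hXμ _
        _ ≤ (2 ^ k)⁻¹ := by
            gcongr
            · norm_num
            · omega
        _ = _ := by rw [one_div, inv_pow]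
  have hnopos : ¬ ∃ μ : B → ℝ≥0, Maharam.IsMeasure μ ∧ Maharam.IsPositive μ := by
    rintro ⟨μ, hμ, hμpos⟩
    obtain ⟨Y, -, hYν, hYμ⟩ := hsmall μ hμ
    have h1 : Y 0 = ⊤ := compl_eq_bot.mp (hμpos _ (hYμ 0))
    have h2 : ν (j ⊤) ≤ 2 := by simpa [h1] using hYν 0
    have h3 : (16 : ℝ) ≤ ν (j ⊤) := by
      rw [hj]
      exact Maharam.le_coverWeight fun c hc => hc.le_of_univ
    have h4 : (ν (j ⊤) : ℝ) ≤ 2 := by exact_mod_cast h2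
    linarith
  refine ⟨B, iB, ⟨hσ, ν, hν, hpos, hcont⟩, ?_, hnopos, ?_⟩
  · rintro ⟨-, μ, hμ, hμpos, -⟩
    exact hnopos ⟨μ, hμ, hμpos⟩
  · rintro ⟨μ, hμ, hμc, hμ0⟩
    obtain ⟨Y, hYanti, hYν, hYμ⟩ := hsmall μ hμ
    have hlim : Filter.Tendsto (fun K : ℕ => 2 * ((2 : ℝ≥0) ^ K)⁻¹) Filter.atTop (nhds 0) := by
      have h1 : Filter.Tendsto (fun K : ℕ => ((2 : ℝ≥0)⁻¹) ^ K) Filter.atTop (nhds 0) :=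
        NNReal.tendsto_pow_atTop_nhds_zero_of_lt_one (by rw [← NNReal.coe_lt_coe]; norm_num)
      simpa [inv_pow] using h1.const_mul 2
    -- A lower bound of all `Y K` has `ν` equal to zero, and `ν` is positive.
    have hglb : IsGLB (Set.range Y) ⊥ := by
      refine ⟨fun _ _ => bot_le, fun l hl => (hpos l ?_).le⟩
      refine le_antisymm (ge_of_tendsto' hlim fun K => ?_) zero_le
      exact (hν.mono _ _ (hl ⟨K, rfl⟩)).trans (hYν K)
    have htop : μ ⊤ = 0 := by
      refine le_antisymm (ge_of_tendsto' (hμc Y hYanti hglb) fun K => ?_) zero_le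
      calc μ ⊤ = μ (Y K ⊔ (Y K)ᶜ) := by rw [sup_compl_eq_top]
        _ ≤ μ (Y K) + μ (Y K)ᶜ := hμ.map_sup_le _ _
        _ = μ (Y K) := by rw [hYμ, add_zero]
    refine hμ0 (funext fun a => le_antisymm ?_ zero_le)
    exact (hμ.mono _ _ le_top).trans htop.le
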